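/- Let $\mathbb{T}$ be the unit circle with normalized arc-length measure and, for $p\in\{2,\infty\}$, let $H^p\subseteq L^p(\mathbb{T})$ be the Hardy space of functions whose Fourier coefficients of negative index vanish; each $f\in H^p$ is identified with its analytic extension $f(z)=\sum_{n\ge 0}\hat f(n)z^n$ to the open unit disk $\mathbb{D}$. Inner products are linear in the first variable. Call $g\in H^2$ outer if $H^\infty g$ is dense in $H^2$. Let $\mathcal{A}$ be a unital subalgebra of $H^\infty$ (containing the constant function $1$) that is closed in the weak$^*$ topology of $L^\infty=(L^1)^*$. For an outer function $g$ let $K_g$ be the reproducing kernel on $\mathbb{D}$ of the closure $[\mathcal{A}g]$ of $\mathcal{A}g$ in $H^2$; that is, $K_g(x,y)=k_y(x)$, where $k_y\in[\mathcal{A}g]$ satisfies $f(y)=\langle f,k_y\rangle$ for all $f\in[\mathcal{A}g]$. Let $x_1,\dots,x_n\in\mathbb{D}$, $v_1,\dots,v_n\in\ell^2=\ell^2(\mathbb{N})$, $w_1,\dots,w_n\in\mathbb{C}$ and let $\alpha\ge 0$ be a real number. Then the following are equivalent: (i) there is a function $F=(f_k)_{k}:\mathbb{D}\to\ell^2$ with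 $f_k\in\mathcal{A}$ for every $k$, such that $\sup_{z\in\mathbb{D}}\|F(z)\|_{\ell^2}\le\alpha$ and $\langle v_j,F(x_j)\rangle=\overline{w_j}$ for $j=1,\dots,n$; (ii) for every outer function $g\in H^2$ with $\|g\|_2=1$, the $n\times n$ matrix $$Q_g=\left[(\alpha^2\langle v_j,v_i\rangle-w_i\overline{w_j})\,K_g(x_i,x_j)\right]_{i,j=1}^n$$ is positive semidefinite. -/

import Mathlib

open MeasureTheory AddCircle
open scoped ENNReal ComplexOrder ComplexConjugate Complex.UnitDisc Topology

noncomputable section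

/-- `L^p` of the unit circle (parametrized as `ℝ/ℤ`, `t ↦ e^{2πit}`) with respect to normalized
arc-length measure. -/
abbrev CircleLp (p : ℝ≥0∞) : Type :=
  Lp ℂ p (haarAddCircle : Measure UnitAddCircle)

theorem CircleLp.integrable {p : ℝ≥0∞} [hp : Fact (1 ≤ p)] (f : CircleLp p) :
    Integrable f (haarAddCircle : Measure UnitAddCircle) :=
  (Lp.memLp f).integrable hp.out

theorem CircleLp.fourierCoeff_add {p : ℝ≥0∞} [Fact (1 ≤ p)] (f g : CircleLp p) (n : ℤ) :
    fourierCoeff (f + g : CircleLp p) n = fourierCoeff f n + fourierCoeff g n := by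
  rw [fourierCoeff_congr_ae (Lp.coeFn_add f g), fourierCoeff.add f.integrable g.integrable]
  rfl

theorem CircleLp.fourierCoeff_smul {p : ℝ≥0∞} [Fact (1 ≤ p)] (c : ℂ) (f : CircleLp p) (n : ℤ) :
    fourierCoeff (c • f : CircleLp p) n = c * fourierCoeff f n := by
  rw [fourierCoeff_congr_ae (Lp.coeFn_smul c f)]
  exact fourierCoeff.const_smul f c n

/-- The Hardy space `H^p` of the circle, `1 ≤ p ≤ ∞`: the functions in `L^p` whose Fourier
coefficients of negative index vanish. -/
def hardySpace (p : ℝ≥0∞) [Fact (1 ≤ p)] : Submodule ℂ (CircleLp p) where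
  carrier := {f | ∀ n : ℤ, n < 0 → fourierCoeff f n = 0}
  add_mem' {f g} hf hg n hn := by
    rw [CircleLp.fourierCoeff_add, hf n hn, hg n hn, add_zero]
  zero_mem' n _ := by
    rw [fourierCoeff_congr_ae (Lp.coeFn_zero ℂ p _)]
    simp [fourierCoeff]
  smul_mem' c f hf n hn := by
    rw [CircleLp.fourierCoeff_smul, hf n hn, mul_zero]

/-- The Hardy space `H²`. -/
abbrev H2 : Submodule ℂ (CircleLp 2) := hardySpace 2

/-- The Hardy space `H^∞`. -/
abbrev HInf : Submodule ℂ (CircleLp ∞) := hardySpace ∞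

/-- The value at a point `z` of the open unit disk of the analytic extension
`∑ₙ f̂(n) zⁿ` of a function `f` in a Hardy space. -/
def diskEval (f : UnitAddCircle → ℂ) (z : 𝔻) : ℂ :=
  ∑' n : ℕ, fourierCoeff f n * (z : ℂ) ^ n

/-! ### `H²` and its subspaces as reproducing kernel Hilbert spaces on the disk -/

theorem norm_fourierCoeff_le (f : CircleLp 2) (n : ℤ) : ‖fourierCoeff f n‖ ≤ ‖f‖ := by
  rw [← fourierBasis_repr, ← fourierBasis.repr.norm_map f]
  exact lp.norm_apply_le_norm (by norm_num) _ n

theorem norm_diskEval_term_le (f : CircleLp 2) (z : 𝔻) (n : ℕ) :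
    ‖fourierCoeff f n * (z : ℂ) ^ n‖ ≤ ‖f‖ * ‖(z : ℂ)‖ ^ n := by
  rw [norm_mul, norm_pow]
  exact mul_le_mul_of_nonneg_right (norm_fourierCoeff_le f n) (by positivity)

theorem hasSum_diskEval_bound (f : CircleLp 2) (z : 𝔻) :
    HasSum (fun n : ℕ => ‖f‖ * ‖(z : ℂ)‖ ^ n) (‖f‖ * (1 - ‖(z : ℂ)‖)⁻¹) :=
  (hasSum_geometric_of_lt_one (norm_nonneg _) z.norm_lt_one).mul_left _

theorem summable_diskEval (f : CircleLp 2) (z : 𝔻) :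
    Summable (fun n : ℕ => fourierCoeff f n * (z : ℂ) ^ n) :=
  .of_norm_bounded (hasSum_diskEval_bound f z).summable (norm_diskEval_term_le f z)

/-- Evaluation at a point of the disk, as a bounded functional on `L²`. -/
def diskEvalCLM (z : 𝔻) : CircleLp 2 →L[ℂ] ℂ :=
  LinearMap.mkContinuous
    { toFun := fun f => diskEval f z
      map_add' := fun f g => by
        simp only [diskEval, CircleLp.fourierCoeff_add, add_mul]
        exact (summable_diskEval f z).tsum_add (summable_diskEval g z)
      map_smul' := fun c f => by
        simp only [diskEval, CircleLp.fourierCoeff_smul, mul_assoc, tsum_mul_left]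
        rfl }
    (1 - ‖(z : ℂ)‖)⁻¹
    (fun f => by
      rw [mul_comm]
      exact tsum_of_norm_bounded (hasSum_diskEval_bound f z) (norm_diskEval_term_le f z))

/-- A function in `H²` is determined by its values in the disk. -/
theorem eq_zero_of_diskEval_eq_zero (f : CircleLp 2) (hf : f ∈ H2)
    (h : ∀ z : 𝔻, diskEval f z = 0) : f = 0 := by
  have hcoef : ∀ n : ℕ, fourierCoeff f n = 0 := by
    let p : FormalMultilinearSeries ℂ ℂ ℂ :=
      FormalMultilinearSeries.ofScalars ℂ (fun n : ℕ => fourierCoeff f n)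
    have hp : HasFPowerSeriesAt (0 : ℂ → ℂ) p 0 := by
      rw [hasFPowerSeriesAt_iff]
      filter_upwards [Metric.ball_mem_nhds (0 : ℂ) one_pos] with z hz
      have hz' : ‖z‖ < 1 := by simpa using hz
      have := (summable_diskEval f (.mk z hz')).hasSum
      rw [show ∑' n : ℕ, fourierCoeff f n * ((Complex.UnitDisc.mk z hz' : 𝔻) : ℂ) ^ n = 0 from h _] at this
      simpa [p, mul_comm] using this
    intro n
    have h0 : p.coeff n = 0 := by
      rw [hp.eq_zero]
      rfl
    rwa [FormalMultilinearSeries.coeff_ofScalars] at h0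
  apply (fourierBasis (T := 1)).repr.injective
  ext n
  rw [fourierBasis_repr, map_zero]
  rcases lt_or_ge n 0 with hn | hn
  · exact hf n hn
  · lift n to ℕ using hn
    exact hcoef n

/-- Any subspace of `H²` is a space of functions on the disk with bounded point evaluations. -/
instance instRKHSSubspaceH2 (M : Submodule ℂ H2) : RKHS ℂ M 𝔻 ℂ where
  coeCLM := ContinuousLinearMap.pi fun z => diskEvalCLM z ∘L H2.subtypeL ∘L M.subtypeL
  coeCLM_injective := by
    refine (injective_iff_map_eq_zero _).2 fun f hf => ?_
    have := eq_zero_of_diskEval_eq_zero (f : H2) (f : H2).2 fun z => congrFun hf z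
    exact Subtype.ext (Subtype.ext this)

theorem isClosed_H2 : IsClosed (H2 : Set (CircleLp 2)) := by
  have : (H2 : Set (CircleLp 2)) = ⋂ (n : ℤ) (_ : n < 0), {f : CircleLp 2 | fourierCoeff f n = 0} := by
    ext f
    simp [hardySpace]
  rw [this]
  refine isClosed_biInter fun n _ => isClosed_eq ?_ continuous_const
  simp_rw [← fourierBasis_repr]
  exact (lp.evalCLM ℂ _ 2 n).continuous.comp (fourierBasis (T := 1)).repr.continuous

instance instCompleteSpaceH2 : CompleteSpace H2 := isClosed_H2.completeSpace_coe

/-! ### Subalgebras of `H^∞`, outer functions and the kernels `K_g` -/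

/-- The weak* topology of `L^∞ = (L¹)*`: the coarsest topology for which
`f ↦ ∫ f h` is continuous for every `h ∈ L¹`. -/
@[reducible] def weakStarTopology : TopologicalSpace (CircleLp ∞) :=
  TopologicalSpace.induced
    (fun (f : CircleLp ∞) (h : CircleLp 1) => ∫ t, f t * h t ∂haarAddCircle)
    Pi.topologicalSpace

/-- `A` is a unital weak*-closed subalgebra of `H^∞`. Here `f • g` is the pointwise product. -/
structure IsUnitalWeakStarClosedSubalgebra (A : Submodule ℂ (CircleLp ∞)) : Prop where
  le_HInf : A ≤ HInf
  one_mem : Lp.const ∞ haarAddCircle (1 : ℂ) ∈ A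
  mul_mem : ∀ f ∈ A, ∀ g ∈ A, (f • g : CircleLp ∞) ∈ A
  isClosed : IsClosed[weakStarTopology] (A : Set (CircleLp ∞))

/-- `[A g]`, the smallest closed subspace of `H²` containing the products `a g`, `a ∈ A`. -/
def cyclicSubspace (A : Submodule ℂ (CircleLp ∞)) (g : H2) : Submodule ℂ H2 :=
  (Submodule.span ℂ
    {h : H2 | ∃ a ∈ A, (h : CircleLp 2) = (a • (g : CircleLp 2) : CircleLp 2)}).topologicalClosure

instance instCompleteSpaceCyclicSubspace (A : Submodule ℂ (CircleLp ∞)) (g : H2) :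
    CompleteSpace (cyclicSubspace A g) :=
  (Submodule.isClosed_topologicalClosure _).completeSpace_coe

/-- `g ∈ H²` is outer if `H^∞ g` is dense in `H²`. -/
def IsOuter (g : H2) : Prop := cyclicSubspace HInf g = ⊤

/-- `K_g`, the reproducing kernel of the space `[A g]` of functions on the disk. -/
def cyclicKernel (A : Submodule ℂ (CircleLp ∞)) (g : H2) (x y : 𝔻) : ℂ :=
  RKHS.kernel (cyclicSubspace A g) x y 1

/-! ### Tangential interpolation -/

/-- The sequence space `ℓ²(ℕ)`. -/
abbrev ellTwo : Type := lp (fun _ : ℕ => ℂ) 2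

/-- The functions `F : 𝔻 → ℓ²` all of whose entries are (extensions to the disk of)
elements of `A`. -/
def columnFunctions (A : Submodule ℂ (CircleLp ∞)) : Set (𝔻 → ellTwo) :=
  {F | ∀ k : ℕ, ∃ f ∈ A, ∀ z : 𝔻, F z k = diskEval f z}

/-- `Q_g = [(α² ⟨v_j, v_i⟩ - w_i conj(w_j)) K_g(x_i, x_j)]`, where `⟨·,·⟩` is linear in the
first variable; `inner ℂ` is linear in the second. -/
def pickMatrix {n : ℕ} (A : Submodule ℂ (CircleLp ∞)) (x : Fin n → 𝔻) (v : Fin n → ellTwo)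
    (w : Fin n → ℂ) (α : ℝ) (g : H2) : Matrix (Fin n) (Fin n) ℂ :=
  Matrix.of fun i j =>
    ((α : ℂ) ^ 2 * inner ℂ (v i) (v j) - w i * conj (w j)) * cyclicKernel A g (x i) (x j)

end

/-! Necessity. A column $F=(f_k)$ over $A$ bounded by $\alpha$ on the disk multiplies $[Ag]$ into a
direct sum of copies of $[Ag]$ with norm at most $\alpha$ (`sum_norm_mulL_sq_le`). If $\kappa_j$ is
the kernel vector at $x_j$, the adjoint sends $(\sum_j b_j v_j(k)\kappa_j)_k$ to $\sum_j
b_j\overline{w_j}\kappa_j$. The norm inequality so obtained, for all $b$, is positivity of $Q_g$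
(`posSemidef_iff_norm_sq_le`).

Sufficiency is a duality argument in $L^1(\ell^2)$. Let $P_z$ be a probability density representing
evaluation at $z$ on $H^\infty$, and let $N$ be the space of $h$ whose entries are annihilated by
$A$. An interpolating column amounts to a functional $\Lambda$ of norm at most $\alpha$ that
vanishes on $N$ and takes the value $w_j$ at $\overline{v_j}P_{x_j}$. By Hahn–Banach it is enough
that $|\sum_j c_jw_j|\le\alpha\|h\|_1$ for $h=\sum_j c_j\overline{v_j}P_{x_j}+m$ with $m\in N$.

To prove this bound, factor $h_k=\overline{p_k}\,g$ with $g$ outer of norm one and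
$\sum_k\|p_k\|^2\le(\|h\|_1+\delta)^2$ (`exists_outer_factorization`). On $[Ag]$ the functional
$\langle\cdot,p_k\rangle$ is a combination of evaluations at the $x_j$, so $p_k$ projects to a
combination of kernels. Positivity of $Q_g$, tested against the vector $g$, gives the bound up to
$\delta$ (`norm_sum_le_of_posSemidef`). Finally the coordinates of $\Lambda$ are bounded functions,
and they lie in $A$ because $A$ is weak* closed (`mem_of_forall_pairing_eq_zero`).

The outer function with prescribed modulus comes from Beurling's wandering vector argument
(`exists_isOuter_norm_eq`). -/

noncomputable section

/-! ### Multiplication operators on `L²` and Fourier coefficients -/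

/-- Multiplication by a bounded function, as a bounded operator on `L²`. -/
def mulL (a : CircleLp ∞) : CircleLp 2 →L[ℂ] CircleLp 2 :=
  (ContinuousLinearMap.lsmul ℂ ℂ).holderL haarAddCircle ∞ 2 2 a

theorem mulL_apply (a : CircleLp ∞) (u : CircleLp 2) : mulL a u = a • u := rfl

theorem coeFn_mulL (a : CircleLp ∞) (u : CircleLp 2) :
    mulL a u =ᵐ[haarAddCircle] fun t => a t * u t :=
  Lp.coeFn_lpSMul a u

theorem fourierCoeff_eq_inner (u : CircleLp 2) (n : ℤ) :
    fourierCoeff u n = inner ℂ (fourierLp (T := 1) 2 n) u := by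
  rw [← fourierBasis_repr, HilbertBasis.repr_apply_apply, coe_fourierBasis]

theorem fourierCoeff_fourierLp (m n : ℤ) :
    fourierCoeff (fourierLp (T := 1) 2 m) n = if n = m then 1 else 0 := by
  rw [fourierCoeff_congr_ae (coeFn_fourierLp 2 m), fourierCoeff_fourier, Pi.single_apply]

/-- The `n`-th Fourier coefficient as a bounded functional on `L²`. -/
def fourierCoeffCLM (n : ℤ) : CircleLp 2 →L[ℂ] ℂ :=
  innerSL ℂ (fourierLp (T := 1) 2 n)

theorem fourierCoeffCLM_apply (n : ℤ) (u : CircleLp 2) :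
    fourierCoeffCLM n u = fourierCoeff u n :=
  (fourierCoeff_eq_inner u n).symm

theorem fourierCoeff_mulL_fourierLp (a : CircleLp ∞) (m n : ℤ) :
    fourierCoeff (mulL a (fourierLp 2 m)) n = fourierCoeff a (n - m) := by
  refine integral_congr_ae ?_
  filter_upwards [coeFn_mulL a (fourierLp 2 m), coeFn_fourierLp (T := 1) 2 m] with t h₁ h₂
  rw [h₁, h₂, show -(n - m) = -n + m by ring, fourier_add]
  simp only [smul_eq_mul]
  ring

/-- Expand $u$ in its Fourier series: by continuity each coefficient of $au$ is $\sum_m \hat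
u(m)\hat a(n-m)$, and for $n<0$ one of the two indices is always negative. -/
theorem mulL_mem_H2 {a : CircleLp ∞} (ha : a ∈ HInf) {u : CircleLp 2} (hu : u ∈ H2) :
    mulL a u ∈ H2 := by
  intro n hn
  have h := (hasSum_fourier_series_L2 u).mapL (fourierCoeffCLM n ∘L mulL a)
  rw [← fourierCoeffCLM_apply]
  refine (h.unique ?_)
  convert hasSum_zero with m
  rw [map_smul, ContinuousLinearMap.comp_apply, fourierCoeffCLM_apply,
    fourierCoeff_mulL_fourierLp, smul_eq_mul]
  rcases lt_or_ge m 0 with hm | hm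
  · rw [hu m hm, zero_mul]
  · rw [ha (n - m) (by omega), mul_zero]

theorem diskEvalCLM_apply (z : 𝔻) (u : CircleLp 2) : diskEvalCLM z u = diskEval u z := rfl

theorem diskEval_mulL_fourierLp {a : CircleLp ∞} (ha : a ∈ HInf) (m : ℕ) (z : 𝔻) :
    diskEval (mulL a (fourierLp 2 m)) z = (z : ℂ) ^ m * diskEval a z := by
  have hs := summable_diskEval (mulL a (fourierLp 2 (m : ℤ))) z
  -- The first $m$ coefficients of $a e_m$ vanish, so the series starts at $m$.
  rw [diskEval, ← hs.sum_add_tsum_nat_add m, Finset.sum_eq_zero, zero_add, diskEval,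
    ← tsum_mul_left]
  · refine tsum_congr fun i => ?_
    rw [fourierCoeff_mulL_fourierLp, pow_add]
    push_cast
    rw [add_sub_cancel_right]
    ring
  · intro i hi
    rw [fourierCoeff_mulL_fourierLp, ha _ (by have := Finset.mem_range.1 hi; omega), zero_mul]

/-- Evaluation at a point of the disk is multiplicative. -/
theorem diskEval_mulL {a : CircleLp ∞} (ha : a ∈ HInf) {u : CircleLp 2} (hu : u ∈ H2) (z : 𝔻) :
    diskEval (mulL a u) z = diskEval a z * diskEval u z := by
  have h := (hasSum_fourier_series_L2 u).mapL (diskEvalCLM z ∘L mulL a)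
  have h₂ : HasSum (fun n : ℤ => (diskEvalCLM z ∘L mulL a) (fourierCoeff u n • fourierLp 2 n))
      (diskEval a z * diskEval u z) := by
    have hinj : Function.Injective ((↑) : ℕ → ℤ) := Nat.cast_injective
    refine (hinj.hasSum_iff ?_).1 ?_
    · intro n hn
      rw [hu n (by contrapose! hn; exact ⟨n.toNat, by simpa using hn⟩), zero_smul, map_zero]
    · have hu' := (summable_diskEval u z).hasSum.mul_left (diskEval a z)
      refine hu'.congr_fun fun n => ?_
      rw [Function.comp_apply, map_smul, ContinuousLinearMap.comp_apply, diskEvalCLM_apply,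
        diskEval_mulL_fourierLp ha, smul_eq_mul]
      ring
  exact h.unique h₂

theorem fourierLp_mem_H2 (n : ℕ) : fourierLp (T := 1) 2 n ∈ H2 := by
  intro m hm
  rw [fourierCoeff_fourierLp, if_neg (by omega)]

theorem diskEval_fourierLp (n : ℕ) (z : 𝔻) : diskEval (fourierLp (T := 1) 2 n) z = (z : ℂ) ^ n := by
  rw [diskEval, tsum_eq_single n]
  · rw [fourierCoeff_fourierLp, if_pos rfl, one_mul]
  · intro m hm
    rw [fourierCoeff_fourierLp, if_neg (by exact_mod_cast hm), zero_mul]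

theorem diskEval_fourierLp_zero (z : 𝔻) : diskEval (fourierLp (T := 1) 2 0) z = 1 := by
  simpa using diskEval_fourierLp 0 z

/-- The square of the modulus of an `L²` function as an element of `L¹`. -/
def normSqL1 (s : CircleLp 2) : CircleLp 1 :=
  (memLp_one_iff_integrable.2 (L2.integrable_inner (𝕜 := ℂ) s s)).toLp _

theorem coeFn_normSqL1 (s : CircleLp 2) :
    normSqL1 s =ᵐ[haarAddCircle] fun t => conj (s t) * s t := by
  filter_upwards [MemLp.coeFn_toLp
    (memLp_one_iff_integrable.2 (L2.integrable_inner (𝕜 := ℂ) s s))] with t ht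
  rw [normSqL1, ht, RCLike.inner_apply, mul_comm]

theorem integral_mul_normSqL1 (a : CircleLp ∞) (s : CircleLp 2) :
    ∫ t, a t * normSqL1 s t ∂haarAddCircle = inner ℂ s (mulL a s) := by
  rw [L2.inner_def]
  refine integral_congr_ae ?_
  filter_upwards [coeFn_mulL a s, coeFn_normSqL1 s] with t h₁ h₂
  rw [h₁, h₂, RCLike.inner_apply]
  ring

theorem norm_normSqL1 (s : CircleLp 2) : ‖normSqL1 s‖ = ‖s‖ ^ 2 := by
  rw [L1.norm_eq_integral_norm, ← RCLike.ofReal_inj (K := ℂ)]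
  have := inner_self_eq_norm_sq_to_K (𝕜 := ℂ) s
  rw [RCLike.ofReal_pow, ← this, L2.inner_def, ← integral_ofReal]
  refine integral_congr_ae ?_
  filter_upwards [coeFn_normSqL1 s] with t h₂
  rw [h₂, inner_self_eq_norm_sq_to_K, norm_mul, RCLike.norm_conj]
  push_cast
  ring

/-- Evaluation of bounded analytic functions at a point of the disk is integration against a
probability density. -/
theorem exists_representing_density (z : 𝔻) : ∃ P : CircleLp 1, ‖P‖ = 1 ∧
    ∀ a ∈ HInf, ∫ t, a t * P t ∂haarAddCircle = diskEval a z := by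
  -- With $s$ the kernel at $z$, $\int a|s|^2=\langle as,s\rangle=a(z)s(z)=a(z)\|s\|^2$, so
  -- $P=|s|^2/\|s\|^2$ works.
  set s : CircleLp 2 := (InnerProductSpace.toDual ℂ _).symm (diskEvalCLM z) with hs
  have hs' : ∀ u, inner ℂ s u = diskEval u z := fun u => by
    rw [hs, InnerProductSpace.toDual_symm_apply, diskEvalCLM_apply]
  have hs0 : s ≠ 0 := by
    intro h
    have := hs' (fourierLp 2 0)
    rw [diskEval_fourierLp_zero, h, inner_zero_left] at this
    exact zero_ne_one this
  -- Evaluation ignores coefficients of negative index, so $s$ is orthogonal to $e_n$ for $n<0$.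
  have hsH : s ∈ H2 := by
    intro n hn
    rw [fourierCoeff_eq_inner, ← inner_conj_symm, hs', diskEval]
    simp only [fourierCoeff_fourierLp]
    rw [(tsum_congr fun m => _).trans tsum_zero, map_zero]
    intro m
    rw [if_neg (by omega), zero_mul]
  have hn : ‖s‖ ≠ 0 := norm_ne_zero_iff.2 hs0
  refine ⟨(((‖s‖ ^ 2)⁻¹ : ℝ) : ℂ) • normSqL1 s, ?_, fun a ha => ?_⟩
  · rw [norm_smul, norm_normSqL1, Complex.norm_real, Real.norm_eq_abs, abs_of_nonneg (by positivity)]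
    field_simp
  · have h : ∫ t, a t * ((((‖s‖ ^ 2)⁻¹ : ℝ) : ℂ) • normSqL1 s : CircleLp 1) t ∂haarAddCircle =
        (((‖s‖ ^ 2)⁻¹ : ℝ) : ℂ) * ∫ t, a t * normSqL1 s t ∂haarAddCircle := by
      rw [← integral_const_mul]
      refine integral_congr_ae ?_
      filter_upwards [Lp.coeFn_smul (((‖s‖ ^ 2)⁻¹ : ℝ) : ℂ) (normSqL1 s)] with t h₁
      rw [h₁, Pi.smul_apply, smul_eq_mul]
      ring
    rw [h, integral_mul_normSqL1, hs', diskEval_mulL ha hsH, ← hs', inner_self_eq_norm_sq_to_K]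
    have : (‖s‖ : ℂ) ≠ 0 := by exact_mod_cast hn
    push_cast
    field_simp
    simp [mul_comm]

/-! ### Outer functions with prescribed modulus -/

theorem inner_mulL_left (a : CircleLp ∞) (u v : CircleLp 2) :
    inner ℂ (mulL a u) v = inner ℂ u (mulL (star a) v) := by
  rw [L2.inner_def, L2.inner_def]
  refine integral_congr_ae ?_
  filter_upwards [coeFn_mulL a u, coeFn_mulL (star a) v, Lp.coeFn_star a] with t h₁ h₂ h₃
  rw [h₁, h₂, h₃, RCLike.inner_apply, RCLike.inner_apply, Pi.star_apply, map_mul,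
    RCLike.star_def]
  ring

theorem mulL_comm (a b : CircleLp ∞) (u : CircleLp 2) :
    mulL a (mulL b u) = mulL b (mulL a u) := by
  refine Lp.ext ?_
  filter_upwards [coeFn_mulL a u, coeFn_mulL b u, coeFn_mulL a (mulL b u),
    coeFn_mulL b (mulL a u)] with t h₁ h₂ h₃ h₄
  rw [h₃, h₄, h₁, h₂]
  ring

/-- Multiplication by the character `e_n`. -/
def shift (n : ℤ) : CircleLp 2 →L[ℂ] CircleLp 2 := mulL (fourierLp ∞ n)

theorem coeFn_shift (n : ℤ) (u : CircleLp 2) :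
    shift n u =ᵐ[haarAddCircle] fun t => fourier n t * u t := by
  filter_upwards [coeFn_mulL (fourierLp ∞ n) u, coeFn_fourierLp (T := 1) ∞ n] with t h₁ h₂
  rw [shift, h₁, h₂]

theorem shift_shift (m n : ℤ) (u : CircleLp 2) : shift m (shift n u) = shift (m + n) u := by
  refine Lp.ext ?_
  filter_upwards [coeFn_shift m (shift n u), coeFn_shift n u, coeFn_shift (m + n) u]
    with t h₁ h₂ h₃
  rw [h₁, h₂, h₃, fourier_add]
  ring

theorem shift_zero (u : CircleLp 2) : shift 0 u = u := by
  refine Lp.ext ?_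
  filter_upwards [coeFn_shift 0 u] with t h₁
  rw [h₁, fourier_zero, one_mul]

theorem inner_shift_left (n : ℤ) (u v : CircleLp 2) :
    inner ℂ (shift n u) v = inner ℂ u (shift (-n) v) := by
  rw [L2.inner_def, L2.inner_def]
  refine integral_congr_ae ?_
  filter_upwards [coeFn_shift n u, coeFn_shift (-n) v] with t h₁ h₂
  rw [h₁, h₂, RCLike.inner_apply, RCLike.inner_apply, map_mul, fourier_neg]
  ring

theorem shift_mulL (n : ℤ) (a : CircleLp ∞) (u : CircleLp 2) :
    shift n (mulL a u) = mulL a (shift n u) :=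
  mulL_comm _ _ _

/-- If all the nontrivial Fourier coefficients of `|s|²` vanish, then `|s|` is constant. -/
theorem ae_norm_eq_of_inner_shift_eq_zero (s : CircleLp 2)
    (h : ∀ n : ℕ, 0 < n → inner ℂ s (shift n s) = 0) :
    ∀ᵐ t ∂haarAddCircle, ‖s t‖ = ‖s‖ := by
  have hall : ∀ n : ℤ, n ≠ 0 → inner ℂ s (shift n s) = 0 := by
    intro n hn
    rcases lt_or_gt_of_ne hn with hn | hn
    · rw [← inner_conj_symm, inner_shift_left]
      lift -n to ℕ using (by omega) with m hm
      rw [h m (by omega), map_zero]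
    · lift n to ℕ using hn.le
      exact h n (by exact_mod_cast hn)
  -- $\Phi(f)=\int|s|^2f$ and $\Psi(f)=\|s\|^2\int f$ agree on characters, hence on all continuous
  -- functions; so the two measures, and then their densities, coincide.
  let Φ : C(UnitAddCircle, ℂ) →L[ℂ] ℂ :=
    innerSL ℂ s ∘L ((ContinuousLinearMap.lsmul ℂ ℂ).holderL haarAddCircle ∞ 2 2).flip s ∘L
      ContinuousMap.toLp ∞ haarAddCircle ℂ
  let Ψ : C(UnitAddCircle, ℂ) →L[ℂ] ℂ :=
    ((‖s‖ : ℂ) ^ 2) • (fourierCoeffCLM 0 ∘L ContinuousMap.toLp 2 haarAddCircle ℂ)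
  have hΦ : ∀ f, Φ f = ∫ t, ((‖s t‖₊ ^ 2 : NNReal) : ℝ) • f t ∂haarAddCircle := by
    intro f
    change inner ℂ s (mulL (ContinuousMap.toLp ∞ haarAddCircle ℂ f) s) = _
    rw [L2.inner_def]
    refine integral_congr_ae ?_
    filter_upwards [coeFn_mulL (ContinuousMap.toLp ∞ haarAddCircle ℂ f) s,
      ContinuousMap.coeFn_toLp haarAddCircle (p := ∞) (𝕜 := ℂ) f] with t h₁ h₂
    rw [h₁, h₂, RCLike.inner_apply, mul_assoc, RCLike.mul_conj, Complex.real_smul]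
    push_cast
    rw [mul_comm]
    rfl
  have hΨ : ∀ f, Ψ f = ∫ t, ((‖s‖₊ ^ 2 : NNReal) : ℝ) • f t ∂haarAddCircle := by
    intro f
    change (‖s‖ : ℂ) ^ 2 * fourierCoeffCLM 0 (ContinuousMap.toLp 2 haarAddCircle ℂ f) = _
    rw [fourierCoeffCLM_apply, fourierCoeff_toLp, fourierCoeff, integral_smul, Complex.real_smul]
    simp
  have hEq : Φ = Ψ := by
    refine ContinuousLinearMap.ext_on
      (Submodule.dense_iff_topologicalClosure_eq_top.2 span_fourier_closure_eq_top) ?_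
    rintro _ ⟨n, rfl⟩
    have h₁ : Φ (fourier n) = inner ℂ s (shift n s) := rfl
    have h₂ : Ψ (fourier n) = (‖s‖ : ℂ) ^ 2 * fourierCoeff (fourierLp (T := 1) 2 n) 0 := by
      change (‖s‖ : ℂ) ^ 2 * fourierCoeffCLM 0 (fourierLp 2 n) = _
      rw [fourierCoeffCLM_apply]
    rw [h₁, h₂, fourierCoeff_fourierLp]
    by_cases hn : n = 0
    · subst hn
      rw [shift_zero, if_pos rfl, mul_one, inner_self_eq_norm_sq_to_K]
      rfl
    · rw [hall n hn, if_neg (Ne.symm hn), mul_zero]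
  have hmeas : Measurable fun t => ‖s t‖₊ ^ 2 := (Lp.stronglyMeasurable s).measurable.nnnorm.pow_const 2
  have hfin : ∫⁻ t, ((‖s t‖₊ ^ 2 : NNReal) : ℝ≥0∞) ∂haarAddCircle ≠ ∞ := by
    have := (L2.integrable_inner (𝕜 := ℂ) s s).2
    rw [HasFiniteIntegral] at this
    convert this.ne using 3 with t
    rw [inner_self_eq_norm_sq_to_K, enorm_pow]
    simp [enorm_eq_nnnorm]
  have hμ : (haarAddCircle (T := 1)).withDensity (fun t => ((‖s t‖₊ ^ 2 : NNReal) : ℝ≥0∞)) =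
      haarAddCircle.withDensity (fun _ => ((‖s‖₊ ^ 2 : NNReal) : ℝ≥0∞)) := by
    have := isFiniteMeasure_withDensity hfin
    have : IsFiniteMeasure
        ((haarAddCircle (T := 1)).withDensity (fun _ => ((‖s‖₊ ^ 2 : NNReal) : ℝ≥0∞))) :=
      isFiniteMeasure_withDensity (by simp)
    refine ext_of_forall_integral_eq_of_IsFiniteMeasure fun f => ?_
    rw [integral_withDensity_eq_integral_smul hmeas,
      integral_withDensity_eq_integral_smul measurable_const]
    let fc : C(UnitAddCircle, ℂ) := ⟨fun t => (f t : ℂ), by fun_prop⟩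
    have h₁ := hΦ fc
    rw [hEq, hΨ fc] at h₁
    have key : ∀ ρ : UnitAddCircle → NNReal, ∫ t, (ρ t : ℝ) • fc t ∂haarAddCircle =
        ((∫ t, ρ t • f t ∂haarAddCircle : ℝ) : ℂ) := by
      intro ρ
      refine Eq.trans ?_ (integral_ofReal (𝕜 := ℂ))
      refine integral_congr_ae (.of_forall fun t => ?_)
      simp [fc, NNReal.smul_def]
    rw [key, key] at h₁
    exact_mod_cast h₁.symm
  filter_upwards [(withDensity_eq_iff hmeas.coe_nnreal_ennreal.aemeasurable
    measurable_const.aemeasurable hfin).1 hμ] with t ht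
  have ht' : ‖s t‖₊ ^ 2 = ‖s‖₊ ^ 2 := by exact_mod_cast ht
  exact congrArg NNReal.toReal ((pow_left_inj₀ zero_le zero_le two_ne_zero).1 ht')

/-! ### Shift-invariant subspaces and wandering vectors -/

/-- The smallest closed subspace of `L²` containing `e_n f` for all `n ≥ 0`. -/
def shiftHull (f : CircleLp 2) : Submodule ℂ (CircleLp 2) :=
  (Submodule.span ℂ (Set.range fun n : ℕ => shift n f)).topologicalClosure

theorem isClosed_shiftHull (f : CircleLp 2) : IsClosed (shiftHull f : Set (CircleLp 2)) :=
  Submodule.isClosed_topologicalClosure _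

theorem shift_mem_shiftHull (f : CircleLp 2) (n : ℕ) : shift n f ∈ shiftHull f :=
  Submodule.le_topologicalClosure _ (Submodule.subset_span ⟨n, rfl⟩)

theorem self_mem_shiftHull (f : CircleLp 2) : f ∈ shiftHull f := by
  have := shift_mem_shiftHull f 0
  rwa [Nat.cast_zero, shift_zero] at this

theorem shiftHull_le {f : CircleLp 2} {N : Submodule ℂ (CircleLp 2)}
    (hN : IsClosed (N : Set (CircleLp 2))) (h : ∀ n : ℕ, shift n f ∈ N) : shiftHull f ≤ N := by
  refine Submodule.topologicalClosure_minimal _ (Submodule.span_le.2 ?_) hN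
  rintro _ ⟨n, rfl⟩
  exact h n

/-- With $k=0$ this is shift invariance of the hull; with $k=1$ it puts all positive shifts of the
hull into the hull of $e_1R$. -/
theorem shift_mem_shiftHull_shift {R f : CircleLp 2} (hf : f ∈ shiftHull R) {n k : ℕ}
    (hkn : k ≤ n) : shift n f ∈ shiftHull (shift k R) := by
  have h : shiftHull R ≤ (shiftHull (shift k R)).comap (shift n).toLinearMap := by
    refine shiftHull_le ((isClosed_shiftHull _).preimage (shift n).continuous) fun m => ?_
    have hm := shift_mem_shiftHull (shift k R) (n - k + m)
    rw [shift_shift] at hm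
    rw [Submodule.mem_comap, ContinuousLinearMap.coe_coe, shift_shift]
    rwa [show ((n - k + m : ℕ) : ℤ) + k = n + m by omega] at hm
  exact h hf

/-- If a bounded multiple of `R` is invertible, the shift-invariant subspace generated by `R`
contains a nonzero wandering vector. -/
theorem exists_wandering_vector {R : CircleLp 2} {b : CircleLp ∞}
    (hb : mulL b R = fourierLp 2 0) :
    ∃ u ∈ shiftHull R, u ≠ 0 ∧ ∀ f ∈ shiftHull R, ∀ n : ℕ, 0 < n → inner ℂ u (shift n f) = 0 := by
  have hb' : ∀ n : ℤ, mulL b (shift n R) = fourierLp 2 n := by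
    intro n
    rw [← shift_mulL, hb]
    refine Lp.ext ?_
    filter_upwards [coeFn_shift n (fourierLp 2 0), coeFn_fourierLp (T := 1) 2 n,
      coeFn_fourierLp (T := 1) 2 0] with t h₁ h₂ h₃
    rw [h₁, h₂, h₃, fourier_zero, mul_one]
  -- Multiplication by $b$ takes $e_nR$ to $e_n$, so the mean of $bf$ vanishes for $f$ in the hull
  -- of $e_1R$ but equals $1$ for $f=R$.
  have hR₁ : R ∉ shiftHull (shift (1 : ℕ) R) := by
    intro hmem
    have hker : shiftHull (shift (1 : ℕ) R) ≤ (fourierCoeffCLM 0 ∘L mulL b).toLinearMap.ker := by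
      refine shiftHull_le (ContinuousLinearMap.isClosed_ker _) fun n => ?_
      rw [LinearMap.mem_ker, ContinuousLinearMap.coe_coe, ContinuousLinearMap.comp_apply,
        shift_shift, hb', fourierCoeffCLM_apply, fourierCoeff_fourierLp, if_neg (by omega)]
    have h0 := LinearMap.mem_ker.1 (hker hmem)
    rw [ContinuousLinearMap.coe_coe, ContinuousLinearMap.comp_apply, hb, fourierCoeffCLM_apply,
      fourierCoeff_fourierLp, if_pos rfl] at h0
    exact one_ne_zero h0
  have hle : shiftHull (shift (1 : ℕ) R) ≤ shiftHull R := by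
    refine shiftHull_le (isClosed_shiftHull _) fun n => ?_
    rw [shift_shift]
    exact_mod_cast shift_mem_shiftHull R (n + 1)
  have : CompleteSpace (shiftHull (shift (1 : ℕ) R)) := (isClosed_shiftHull _).completeSpace_coe
  refine ⟨R - (shiftHull (shift (1 : ℕ) R)).starProjection R, ?_, ?_, fun f hf n hn => ?_⟩
  · exact Submodule.sub_mem _ (self_mem_shiftHull R) (hle (Submodule.starProjection_apply_mem _ _))
  · intro h
    exact hR₁ (Submodule.starProjection_eq_self_iff.1 (sub_eq_zero.1 h).symm)
  · exact Submodule.inner_left_of_mem_orthogonal (shift_mem_shiftHull_shift hf hn)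
      (Submodule.sub_starProjection_mem_orthogonal R)

theorem fourierLp_mem_HInf (n : ℕ) : fourierLp (T := 1) ∞ n ∈ HInf := by
  intro m hm
  rw [fourierCoeff_congr_ae (coeFn_fourierLp ∞ _), fourierCoeff_fourier,
    Pi.single_eq_of_ne (by omega)]

/-- The characters $e_n$, $n\ge0$, belong to $H^\infty$, so orthogonality to $H^\infty g$ implies
orthogonality to every $e_ng$. -/
theorem isOuter_of_forall_inner_shift {g : H2}
    (h : ∀ f ∈ H2, (∀ n : ℕ, inner ℂ (shift n (g : CircleLp 2)) f = 0) → f = 0) : IsOuter g := by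
  rw [IsOuter, cyclicSubspace, Submodule.topologicalClosure_eq_top_iff, Submodule.eq_bot_iff]
  intro f hf
  refine Subtype.ext (h f f.2 fun n => ?_)
  have hn := fourierLp_mem_HInf n
  exact (Submodule.mem_orthogonal _ _).1 hf ⟨shift n g, mulL_mem_H2 hn g.2⟩
    (Submodule.subset_span ⟨_, hn, mulL_apply _ _⟩)

/-- A square integrable function bounded below by a positive constant is the modulus of an outer
function. -/
theorem exists_isOuter_norm_eq {r : UnitAddCircle → ℝ} (hr : MemLp r 2 haarAddCircle) {δ : ℝ}
    (hδ : 0 < δ) (hδr : ∀ t, δ ≤ r t) :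
    ∃ g : H2, IsOuter g ∧ ∀ᵐ t ∂haarAddCircle, ‖(g : CircleLp 2) t‖ = r t := by
  have hr0 : ∀ t, 0 < r t := fun t => hδ.trans_le (hδr t)
  obtain ⟨R, hR⟩ : ∃ R : CircleLp 2, R =ᵐ[haarAddCircle] fun t => (r t : ℂ) :=
    ⟨(hr.ofReal (K := ℂ)).toLp _, MemLp.coeFn_toLp _⟩
  have hinv : MemLp (fun t => ((r t : ℂ))⁻¹) ∞ (haarAddCircle (T := 1)) := by
    refine memLp_top_of_bound ?_ δ⁻¹ (.of_forall fun t => ?_)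
    · exact (hr.ofReal (K := ℂ)).1.inv₀
    · rw [norm_inv, Complex.norm_real, Real.norm_of_nonneg (hr0 t).le]
      exact inv_anti₀ hδ (hδr t)
  have hb : mulL (hinv.toLp _) R = fourierLp 2 0 := by
    refine Lp.ext ?_
    filter_upwards [coeFn_mulL (hinv.toLp _) R, hR, hinv.coeFn_toLp,
      coeFn_fourierLp (T := 1) 2 0] with t h₁ h₃ h₄ h₅
    rw [h₁, h₃, h₄, h₅, fourier_zero]
    have : (r t : ℂ) ≠ 0 := by exact_mod_cast (hr0 t).ne'
    field_simp
  obtain ⟨u, huM, hu0, hu⟩ := exists_wandering_vector hb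
  have hu0 : ‖u‖ ≠ 0 := norm_ne_zero_iff.2 hu0
  have hnorm := ae_norm_eq_of_inner_shift_eq_zero u (hu u huM)
  obtain ⟨U, hU⟩ : ∃ U : CircleLp ∞, U =ᵐ[haarAddCircle] u :=
    ⟨(memLp_top_of_bound (Lp.aestronglyMeasurable u) ‖u‖ (hnorm.mono fun t ht => ht.le)).toLp _,
      MemLp.coeFn_toLp _⟩
  have hUe : ∀ n : ℤ, mulL U (fourierLp 2 n) = shift n u := by
    intro n
    refine Lp.ext ?_
    filter_upwards [coeFn_mulL U (fourierLp 2 n), coeFn_shift n u, hU,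
      coeFn_fourierLp (T := 1) 2 n] with t h₁ h₂ h₃ h₄
    rw [h₁, h₂, h₃, h₄, mul_comm]
  -- Since $|u|=\|u\|$ a.e., $G=\overline uR/\|u\|$ has modulus $r$; it lies in $H^2$ because $u$ is
  -- orthogonal to $e_mR$ for $m>0$.
  obtain ⟨G, hG⟩ : ∃ G : CircleLp 2, G = ((‖u‖⁻¹ : ℝ) : ℂ) • mulL (star U) R := ⟨_, rfl⟩
  have hGH : G ∈ H2 := by
    intro n hn
    obtain ⟨m, hm⟩ : ∃ m : ℕ, -n = m := ⟨(-n).toNat, by omega⟩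
    rw [fourierCoeff_eq_inner, hG, inner_smul_right, ← inner_mulL_left, hUe, inner_shift_left, hm,
      hu _ (self_mem_shiftHull R) m (by omega), mul_zero]
  refine ⟨⟨G, hGH⟩, isOuter_of_forall_inner_shift fun f hf hfG => ?_, ?_⟩
  -- If $f\in H^2$ is orthogonal to all $e_nG$, then $uf$ lies in the hull of $R$ and is also
  -- orthogonal to it; hence $uf=0$, and $u$ has no zeros a.e.
  · have hfM : mulL U f ∈ shiftHull R := by
      refine (isClosed_shiftHull R).mem_of_tendsto
        ((hasSum_fourier_series_L2 f).mapL (mulL U))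
        (.of_forall fun s => Submodule.sum_mem _ fun n _ => ?_)
      rw [map_smul, hUe]
      rcases lt_or_ge n 0 with hn | hn
      · rw [hf n hn, zero_smul]
        exact Submodule.zero_mem _
      · lift n to ℕ using hn
        have := shift_mem_shiftHull_shift huM (Nat.zero_le n)
        rw [Nat.cast_zero, shift_zero] at this
        exact Submodule.smul_mem _ _ this
    have hfM' : shiftHull R ≤ (innerSL ℂ (mulL U f)).toLinearMap.ker := by
      refine shiftHull_le (ContinuousLinearMap.isClosed_ker _) fun n => ?_
      have h : inner ℂ (shift n G) f = 0 := hfG n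
      rw [hG, map_smul, inner_smul_left, mul_eq_zero] at h
      rw [LinearMap.mem_ker, ContinuousLinearMap.coe_coe, innerSL_apply_apply, inner_mulL_left,
        ← shift_mulL, ← inner_conj_symm, h.resolve_left (by simpa using hu0), map_zero]
    have h0 := LinearMap.mem_ker.1 (hfM' hfM)
    rw [ContinuousLinearMap.coe_coe, innerSL_apply_apply, inner_self_eq_zero] at h0
    refine Lp.ext ?_
    have h0' : mulL U f =ᵐ[haarAddCircle] 0 := by rw [h0]; exact Lp.coeFn_zero _ _ _
    filter_upwards [coeFn_mulL U f, h0', hU, hnorm, Lp.coeFn_zero ℂ 2 (haarAddCircle (T := 1))]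
      with t h₁ h₂ h₃ h₄ h₅
    rw [h₂, h₃] at h₁
    have : u t ≠ 0 := by
      rw [← norm_ne_zero_iff, h₄]; exact hu0
    rw [h₅]
    exact (mul_eq_zero.1 h₁.symm).resolve_left this
  · filter_upwards [Lp.coeFn_smul ((‖u‖⁻¹ : ℝ) : ℂ) (mulL (star U) R), coeFn_mulL (star U) R,
      Lp.coeFn_star U, hU, hnorm, hR] with t h₁ h₂ h₃ h₄ h₅ h₆
    rw [hG, h₁, Pi.smul_apply, h₂, h₃, Pi.star_apply, h₄, h₆, norm_smul, norm_mul, norm_star, h₅,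
      Complex.norm_real, Complex.norm_real, Real.norm_of_nonneg (hr0 t).le,
      Real.norm_of_nonneg (by positivity)]
    field_simp

/-! ### Duality between `L¹` and `L^∞` -/

/-- The bilinear pairing `∫ a h` of `a ∈ L^∞` with `h ∈ L¹`. -/
def pairing : CircleLp ∞ →L[ℂ] CircleLp 1 →L[ℂ] ℂ :=
  (ContinuousLinearMap.mul ℂ ℂ).lpPairing haarAddCircle ∞ 1

theorem pairing_apply (a : CircleLp ∞) (h : CircleLp 1) :
    pairing a h = ∫ t, a t * h t ∂haarAddCircle :=
  ContinuousLinearMap.lpPairing_eq_integral _ a h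

/-- The inclusion of `L²` into `L¹`. -/
def inclL1 : CircleLp 2 →L[ℂ] CircleLp 1 :=
  (ContinuousLinearMap.lsmul ℂ ℂ).holderL haarAddCircle 2 2 1 (fourierLp 2 0)

theorem coeFn_inclL1 (f : CircleLp 2) : inclL1 f =ᵐ[haarAddCircle] f := by
  filter_upwards [ContinuousLinearMap.coeFn_holder (r := 1) (ContinuousLinearMap.lsmul ℂ ℂ)
    (fourierLp (T := 1) 2 0) f, coeFn_fourierLp (T := 1) 2 0] with t h₁ h₂
  change ((ContinuousLinearMap.lsmul ℂ ℂ).holder 1 (fourierLp (T := 1) 2 0) f : CircleLp 1) t = _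
  rw [h₁, h₂, fourier_zero]
  simp

theorem denseRange_inclL1 : DenseRange inclL1 := by
  have h := ContinuousMap.toLp_denseRange (p := 1) ℂ (haarAddCircle (T := 1)) ℂ (by simp)
  refine h.mono ?_
  rintro _ ⟨f, rfl⟩
  refine ⟨ContinuousMap.toLp 2 haarAddCircle ℂ f, Lp.ext ?_⟩
  filter_upwards [coeFn_inclL1 (ContinuousMap.toLp 2 haarAddCircle ℂ f),
    ContinuousMap.coeFn_toLp haarAddCircle (p := 2) (𝕜 := ℂ) f,
    ContinuousMap.coeFn_toLp haarAddCircle (p := 1) (𝕜 := ℂ) f] with t h₁ h₂ h₃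
  rw [h₁, h₂, h₃]

/-- Test on $f=1_E\varphi$ with $E=\{|\varphi|>C\}$: then $\int_E|\varphi|^2\le C\int_E|\varphi|$,
which forces $E$ to be null. -/
theorem ae_norm_le_of_forall_norm_inner_le {φ : CircleLp 2} {C : ℝ} (hC : 0 ≤ C)
    (h : ∀ f, ‖inner ℂ φ f‖ ≤ C * ‖inclL1 f‖) : ∀ᵐ t ∂haarAddCircle, ‖φ t‖ ≤ C := by
  have hmeas := Lp.stronglyMeasurable φ
  set E : Set UnitAddCircle := {t | C < ‖φ t‖} with hE
  have hEm : MeasurableSet E := measurableSet_lt measurable_const hmeas.norm.measurable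
  obtain ⟨f, hf⟩ : ∃ f : CircleLp 2, f =ᵐ[haarAddCircle] E.indicator φ :=
    ⟨((Lp.memLp φ).indicator hEm).toLp _, MemLp.coeFn_toLp _⟩
  have h₁ : inner ℂ φ f = ((∫ t, E.indicator (fun t => ‖φ t‖ ^ 2) t ∂haarAddCircle : ℝ) : ℂ) := by
    rw [L2.inner_def]
    refine Eq.trans ?_ (integral_ofReal (𝕜 := ℂ))
    refine integral_congr_ae ?_
    filter_upwards [hf] with t ht
    rw [ht]
    by_cases hm : t ∈ E
    · simp [Set.indicator_of_mem hm]
    · simp [Set.indicator_of_notMem hm]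
  have h₂ : ‖inclL1 f‖ = ∫ t, E.indicator (fun t => ‖φ t‖) t ∂haarAddCircle := by
    rw [L1.norm_eq_integral_norm]
    refine integral_congr_ae ?_
    filter_upwards [hf, coeFn_inclL1 f] with t ht ht'
    rw [ht', ht, norm_indicator_eq_indicator_norm]
  have i₁ : Integrable (E.indicator fun t => ‖φ t‖ ^ 2) haarAddCircle :=
    ((memLp_two_iff_integrable_sq_norm hmeas.aestronglyMeasurable).1 (Lp.memLp φ)).indicator hEm
  have i₂ : Integrable (E.indicator fun t => ‖φ t‖) haarAddCircle := φ.integrable.norm.indicator hEm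
  have h₃ : ∫ t, E.indicator (fun t => ‖φ t‖ ^ 2) t ∂haarAddCircle ≤
      C * ∫ t, E.indicator (fun t => ‖φ t‖) t ∂haarAddCircle := by
    have := h f
    rw [h₁, h₂, Complex.norm_real] at this
    exact (Real.le_norm_self _).trans this
  rw [← integral_const_mul, ← sub_nonpos, ← integral_sub i₁ (i₂.const_mul C)] at h₃
  have hnn : ∀ t, 0 ≤ E.indicator (fun t => ‖φ t‖ ^ 2) t - C * E.indicator (fun t => ‖φ t‖) t := by
    intro t
    by_cases hm : t ∈ E
    · rw [Set.indicator_of_mem hm, Set.indicator_of_mem hm]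
      have : C < ‖φ t‖ := hm
      nlinarith [norm_nonneg (φ t)]
    · simp [Set.indicator_of_notMem hm]
  have h₄ := (integral_eq_zero_iff_of_nonneg hnn (i₁.sub (i₂.const_mul C))).1
    (le_antisymm h₃ (integral_nonneg hnn))
  filter_upwards [h₄] with t ht
  by_contra! hlt
  have hm : t ∈ E := hlt
  rw [Set.indicator_of_mem hm, Set.indicator_of_mem hm, Pi.zero_apply] at ht
  nlinarith

/-- Every bounded functional on `L¹` is integration against a bounded function. -/
theorem exists_pairing_eq (Λ : CircleLp 1 →L[ℂ] ℂ) : ∃ f : CircleLp ∞, pairing f = Λ := by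
  -- Riesz representation on the dense subspace $L^2$; the $L^1$ bound makes $\varphi$ bounded, and
  -- the density sought is $\overline\varphi$.
  set φ : CircleLp 2 := (InnerProductSpace.toDual ℂ _).symm (Λ ∘L inclL1) with hφ
  have hφ' : ∀ u, inner ℂ φ u = Λ (inclL1 u) := fun u => by
    rw [hφ, InnerProductSpace.toDual_symm_apply, ContinuousLinearMap.comp_apply]
  have hb := ae_norm_le_of_forall_norm_inner_le (norm_nonneg Λ) fun f => by
    rw [hφ']; exact Λ.le_opNorm _
  obtain ⟨f, hf⟩ : ∃ f : CircleLp ∞, f =ᵐ[haarAddCircle] φ :=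
    ⟨(memLp_top_of_bound (Lp.aestronglyMeasurable φ) ‖Λ‖ hb).toLp _, MemLp.coeFn_toLp _⟩
  refine ⟨star f, ContinuousLinearMap.ext fun h => ?_⟩
  refine congrFun (denseRange_inclL1.equalizer (pairing (star f)).continuous Λ.continuous
    (funext fun u => ?_)) h
  rw [Function.comp_apply, Function.comp_apply, ← hφ', pairing_apply, L2.inner_def]
  refine integral_congr_ae ?_
  filter_upwards [Lp.coeFn_star f, hf, coeFn_inclL1 u] with t h₁ h₂ h₃
  rw [h₁, h₃, Pi.star_apply, h₂, RCLike.inner_apply, RCLike.star_def, mul_comm]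

/-- A weak* closed subspace of `L^∞` is determined by its annihilator in `L¹`. -/
theorem mem_of_forall_pairing_eq_zero {A : Submodule ℂ (CircleLp ∞)}
    (hA : IsClosed[weakStarTopology] (A : Set (CircleLp ∞))) {f : CircleLp ∞}
    (h : ∀ m : CircleLp 1, (∀ a ∈ A, pairing a m = 0) → pairing f m = 0) : f ∈ A := by
  classical
  by_contra hf
  obtain ⟨t, ht, htA⟩ := isClosed_induced_iff.1 hA
  have hft : (fun m : CircleLp 1 => ∫ s, f s * m s ∂haarAddCircle) ∈ tᶜ := by
    intro hmem
    exact hf (htA.subset hmem)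
  -- A basic weak* neighbourhood of $f$ missing $A$ involves only finitely many $m\in L^1$, so
  -- separation reduces to linear algebra in $\mathbb C^I$.
  obtain ⟨I, u, hu, hI⟩ := isOpen_pi_iff.1 ht.isOpen_compl _ hft
  let T : CircleLp ∞ →ₗ[ℂ] (I → ℂ) :=
    LinearMap.pi fun m => (pairing.flip (m : CircleLp 1)).toLinearMap
  have hT : ∀ a m, T a m = pairing a m := fun a m => rfl
  have hTf : T f ∉ A.map T := by
    rintro ⟨a, ha, hab⟩
    have hat : (fun m : CircleLp 1 => ∫ s, a s * m s ∂haarAddCircle) ∈ t := by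
      have : a ∈ (A : Set (CircleLp ∞)) := ha
      rwa [← htA] at this
    refine hI (fun m hm => ?_) hat
    have := congrFun hab ⟨m, hm⟩
    rw [hT, hT, pairing_apply, pairing_apply] at this
    change ∫ s, a s * m s ∂haarAddCircle ∈ u m
    rw [this]
    exact (hu m hm).2
  obtain ⟨l, hl, hlA⟩ := Submodule.exists_le_ker_of_notMem hTf
  have hlT : ∀ a, l (T a) = pairing a (∑ m : I, l (Pi.single m 1) • (m : CircleLp 1)) := by
    intro a
    rw [LinearMap.pi_apply_eq_sum_univ l, map_sum]
    refine Finset.sum_congr rfl fun m _ => ?_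
    rw [map_smul, hT, smul_eq_mul, smul_eq_mul, mul_comm]
    congr 2
    ext i
    simp [Pi.single_apply, eq_comm]
  refine hl ?_
  rw [hlT]
  refine h _ fun a ha => ?_
  rw [← hlT]
  exact hlA ⟨a, ha, rfl⟩

/-- Hahn–Banach: a linear functional dominated by the norm of the image of a linear map extends
to a bounded functional on the codomain. -/
theorem exists_clm_comp_eq {V E : Type*} [AddCommGroup V] [Module ℂ V] [NormedAddCommGroup E]
    [NormedSpace ℂ E] (T : V →ₗ[ℂ] E) (l : V →ₗ[ℂ] ℂ) {α : ℝ} (hα : 0 ≤ α)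
    (h : ∀ v, ‖l v‖ ≤ α * ‖T v‖) :
    ∃ Λ : E →L[ℂ] ℂ, ‖Λ‖ ≤ α ∧ ∀ v, Λ (T v) = l v := by
  -- The bound makes $l$ descend to the range of $T$, even when $T$ is not injective.
  have hker : T.ker ≤ l.ker := by
    intro v hv
    have := h v
    rw [LinearMap.mem_ker.1 hv, norm_zero, mul_zero] at this
    exact norm_le_zero_iff.1 this
  let l₀ : T.range →ₗ[ℂ] ℂ := T.ker.liftQ l hker ∘ₗ T.quotKerEquivRange.symm.toLinearMap
  have hl₀ : ∀ v, l₀ ⟨T v, v, rfl⟩ = l v := by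
    intro v
    have : T.quotKerEquivRange.symm ⟨T v, v, rfl⟩ = T.ker.mkQ v := by
      rw [LinearEquiv.symm_apply_eq]
      rfl
    change T.ker.liftQ l hker (T.quotKerEquivRange.symm ⟨T v, v, rfl⟩) = l v
    rw [this]
    rfl
  let l₁ : StrongDual ℂ T.range := l₀.mkContinuous α (by
    rintro ⟨_, v, rfl⟩
    rw [hl₀]
    exact h v)
  obtain ⟨Λ, hΛ, hn⟩ := exists_extension_norm_eq T.range l₁
  refine ⟨Λ, hn.trans_le (LinearMap.mkContinuous_norm_le _ hα _), fun v => ?_⟩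
  rw [← hl₀ v]
  exact hΛ ⟨T v, v, rfl⟩

/-! ### Positivity of the Pick matrices -/

section QuadraticForm

variable {n : ℕ} {E : Type*} [NormedAddCommGroup E] [InnerProductSpace ℂ E]

/-- The linear combination `∑ⱼ bⱼ κⱼ`. -/
def lincomb (κ : Fin n → E) (b : Fin n → ℂ) : E := ∑ j, b j • κ j

theorem inner_lincomb_left (κ : Fin n → E) (b : Fin n → ℂ) (f : E) :
    inner ℂ (lincomb κ b) f = ∑ j, conj (b j) * inner ℂ (κ j) f := by
  rw [lincomb, sum_inner]
  exact Finset.sum_congr rfl fun j _ => inner_smul_left _ _ _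

theorem inner_lincomb_lincomb (κ : Fin n → E) (b c : Fin n → ℂ) :
    inner ℂ (lincomb κ b) (lincomb κ c) =
      ∑ i, ∑ j, conj (b i) * (inner ℂ (κ i) (κ j) * c j) := by
  rw [inner_lincomb_left]
  refine Finset.sum_congr rfl fun i _ => ?_
  rw [lincomb, inner_sum, Finset.mul_sum]
  refine Finset.sum_congr rfl fun j _ => ?_
  rw [inner_smul_right]
  ring

/-- Summation over the coordinates of $\ell^2$ assembles $\langle v_j,v_i\rangle$: the sum is the
quadratic form of the entrywise product of two Gram matrices. -/
theorem hasSum_inner_lincomb (κ : Fin n → E) (v : Fin n → ellTwo) (b : Fin n → ℂ) :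
    HasSum (fun k => inner ℂ (lincomb κ fun j => b j * v j k) (lincomb κ fun j => b j * v j k))
      (∑ i, ∑ j, conj (b i) * (inner ℂ (v i) (v j) * inner ℂ (κ i) (κ j)) * b j) := by
  simp_rw [inner_lincomb_lincomb]
  refine hasSum_sum fun i _ => hasSum_sum fun j _ => ?_
  have h := (lp.hasSum_inner (𝕜 := ℂ) (v i) (v j)).mul_left
    (conj (b i) * inner ℂ (κ i) (κ j) * b j)
  rw [show conj (b i) * (inner ℂ (v i) (v j) * inner ℂ (κ i) (κ j)) * b j =
    conj (b i) * inner ℂ (κ i) (κ j) * b j * inner ℂ (v i) (v j) by ring]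
  refine h.congr_fun fun k => ?_
  rw [RCLike.inner_apply, map_mul]
  ring

theorem summable_norm_sq_lincomb (κ : Fin n → E) (v : Fin n → ellTwo) (b : Fin n → ℂ) :
    Summable fun k => ‖lincomb κ fun j => b j * v j k‖ ^ 2 := by
  have h := (hasSum_inner_lincomb κ v b).summable
  simp_rw [inner_self_eq_norm_sq_to_K] at h
  exact_mod_cast h

/-- The quadratic form of the matrix at $b$ is exactly the right side of the inequality minus the
left. -/
theorem posSemidef_iff_norm_sq_le (κ : Fin n → E) (v : Fin n → ellTwo) (w : Fin n → ℂ) (α : ℝ) :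
    (Matrix.of fun i j => ((α : ℂ) ^ 2 * inner ℂ (v i) (v j) - w i * conj (w j)) *
        inner ℂ (κ i) (κ j)).PosSemidef ↔
      ∀ b : Fin n → ℂ, ‖lincomb κ fun j => b j * conj (w j)‖ ^ 2 ≤
        α ^ 2 * ∑' k, ‖lincomb κ fun j => b j * v j k‖ ^ 2 := by
  set Q : Matrix (Fin n) (Fin n) ℂ := Matrix.of fun i j =>
    ((α : ℂ) ^ 2 * inner ℂ (v i) (v j) - w i * conj (w j)) * inner ℂ (κ i) (κ j) with hQ
  have hform : ∀ b : Fin n → ℂ, star b ⬝ᵥ Q.mulVec b =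
      ((α ^ 2 * ∑' k, ‖lincomb κ fun j => b j * v j k‖ ^ 2 -
        ‖lincomb κ fun j => b j * conj (w j)‖ ^ 2 : ℝ) : ℂ) := by
    intro b
    have h₁ : ((∑' k, ‖lincomb κ fun j => b j * v j k‖ ^ 2 : ℝ) : ℂ) =
        ∑ i, ∑ j, conj (b i) * (inner ℂ (v i) (v j) * inner ℂ (κ i) (κ j)) * b j := by
      rw [Complex.ofReal_tsum, ← (hasSum_inner_lincomb κ v b).tsum_eq]
      refine tsum_congr fun k => ?_
      rw [inner_self_eq_norm_sq_to_K]
      push_cast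
      rfl
    have h₂ : ((‖lincomb κ fun j => b j * conj (w j)‖ ^ 2 : ℝ) : ℂ) =
        ∑ i, ∑ j, conj (b i * conj (w i)) * (inner ℂ (κ i) (κ j) * (b j * conj (w j))) := by
      rw [← inner_lincomb_lincomb, inner_self_eq_norm_sq_to_K]
      push_cast
      rfl
    rw [Complex.ofReal_sub, Complex.ofReal_mul, h₁, h₂, Finset.mul_sum, ← Finset.sum_sub_distrib]
    refine Finset.sum_congr rfl fun i _ => ?_
    rw [Finset.mul_sum, ← Finset.sum_sub_distrib, Matrix.mulVec, dotProduct, Finset.mul_sum]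
    refine Finset.sum_congr rfl fun j _ => ?_
    simp only [hQ, Matrix.of_apply, Pi.star_apply, RCLike.star_def, map_mul, Complex.conj_conj]
    push_cast
    ring
  constructor
  · intro h b
    have := h.dotProduct_mulVec_nonneg b
    rw [hform, Complex.zero_le_real] at this
    linarith
  · intro h
    refine .of_dotProduct_mulVec_nonneg ?_ fun b => ?_
    · ext i j
      simp only [hQ, Matrix.conjTranspose_apply, Matrix.of_apply, RCLike.star_def, map_mul, map_sub,
        map_pow, Complex.conj_ofReal, inner_conj_symm, Complex.conj_conj]
      ring
    · rw [hform, Complex.zero_le_real]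
      linarith [h b]

end QuadraticForm

/-! ### The spaces $[Ag]$ and their kernel vectors -/

section Kernel

variable {A : Submodule ℂ (CircleLp ∞)} {g : H2}

theorem cyclicSubspace_apply (f : cyclicSubspace A g) (z : 𝔻) :
    f z = diskEval ((f : H2) : CircleLp 2) z := rfl

variable (A g) in
/-- The reproducing kernel of `[A g]` at a point. -/
def kernelVector (z : 𝔻) : cyclicSubspace A g := RKHS.kerFun (cyclicSubspace A g) z (1 : ℂ)

theorem inner_kernelVector (f : cyclicSubspace A g) (z : 𝔻) :
    inner ℂ (kernelVector A g z) f = diskEval ((f : H2) : CircleLp 2) z := by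
  rw [kernelVector, RKHS.kerFun_inner, cyclicSubspace_apply]
  simp

theorem cyclicKernel_eq_inner (x y : 𝔻) :
    cyclicKernel A g x y = inner ℂ (kernelVector A g x) (kernelVector A g y) := by
  rw [kernelVector, RKHS.kerFun_inner, kernelVector, RKHS.kerFun_apply, cyclicKernel]
  simp

theorem pickMatrix_posSemidef_iff {n : ℕ} (x : Fin n → 𝔻) (v : Fin n → ellTwo) (w : Fin n → ℂ)
    (α : ℝ) : (pickMatrix A x v w α g).PosSemidef ↔ ∀ b : Fin n → ℂ,
      ‖lincomb (fun j => kernelVector A g (x j)) fun j => b j * conj (w j)‖ ^ 2 ≤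
        α ^ 2 * ∑' k, ‖lincomb (fun j => kernelVector A g (x j)) fun j => b j * v j k‖ ^ 2 := by
  have h := posSemidef_iff_norm_sq_le (fun j => kernelVector A g (x j)) v w α
  simp_rw [← cyclicKernel_eq_inner] at h
  exact h

theorem inner_lincomb_kernelVector {n : ℕ} (x : Fin n → 𝔻) (b : Fin n → ℂ)
    (f : cyclicSubspace A g) :
    inner ℂ (lincomb (fun j => kernelVector A g (x j)) b) f =
      ∑ j, conj (b j) * diskEval ((f : H2) : CircleLp 2) (x j) := by
  simp_rw [inner_lincomb_left, inner_kernelVector]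

theorem mulL_mem_cyclicSubspace (hA : A ≤ HInf) {a : CircleLp ∞} (ha : a ∈ A) :
    (⟨mulL a g, mulL_mem_H2 (hA ha) g.2⟩ : H2) ∈ cyclicSubspace A g :=
  Submodule.le_topologicalClosure _ (Submodule.subset_span ⟨a, ha, mulL_apply _ _⟩)

theorem mulL_one (u : CircleLp 2) : mulL (Lp.const ∞ haarAddCircle (1 : ℂ)) u = u := by
  refine Lp.ext ?_
  filter_upwards [coeFn_mulL (Lp.const ∞ haarAddCircle (1 : ℂ)) u,
    Lp.coeFn_const (p := ∞) (μ := haarAddCircle (T := 1)) (c := (1 : ℂ))] with t h₁ h₂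
  rw [h₁, h₂]
  simp

theorem self_mem_cyclicSubspace (hA : A ≤ HInf)
    (h1 : Lp.const ∞ haarAddCircle (1 : ℂ) ∈ A) : g ∈ cyclicSubspace A g := by
  have h := mulL_mem_cyclicSubspace (g := g) hA h1
  convert h
  exact (mulL_one _).symm

/-- To prove that two bounded functionals agree on `[A g]` it is enough to consider `a g`. -/
theorem eqOn_cyclicSubspace {φ ψ : H2 →L[ℂ] ℂ} (hA : A ≤ HInf)
    (h : ∀ a, ∀ ha : a ∈ A, φ ⟨mulL a g, mulL_mem_H2 (hA ha) g.2⟩ =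
      ψ ⟨mulL a g, mulL_mem_H2 (hA ha) g.2⟩) : ∀ u ∈ cyclicSubspace A g, φ u = ψ u := by
  have hle : cyclicSubspace A g ≤ (φ - ψ).toLinearMap.ker := by
    refine Submodule.topologicalClosure_minimal _ (Submodule.span_le.2 ?_)
      (ContinuousLinearMap.isClosed_ker _)
    rintro u ⟨a, ha, hu⟩
    have hu' : u = ⟨mulL a g, mulL_mem_H2 (hA ha) g.2⟩ := Subtype.ext hu
    rw [hu', SetLike.mem_coe, LinearMap.mem_ker, ContinuousLinearMap.coe_coe,
      sub_apply, h a ha, sub_self]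
  intro u hu
  have := LinearMap.mem_ker.1 (hle hu)
  rwa [ContinuousLinearMap.coe_coe, sub_apply, sub_eq_zero] at this

/-- A zero of $g$ at $z$ would make evaluation at $z$ vanish on the dense set $H^\infty g$, hence at
the constant $1$. -/
theorem IsOuter.diskEval_ne_zero (hg : IsOuter g) (z : 𝔻) : diskEval (g : CircleLp 2) z ≠ 0 := by
  intro h0
  have h : ∀ u ∈ cyclicSubspace HInf g, (diskEvalCLM z ∘L H2.subtypeL) u = (0 : H2 →L[ℂ] ℂ) u := by
    refine eqOn_cyclicSubspace le_rfl fun a ha => ?_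
    change diskEval (mulL a g) z = 0
    rw [diskEval_mulL ha g.2, h0, mul_zero]
  have h1 : diskEval (fourierLp (T := 1) 2 0) z = 0 :=
    h ⟨fourierLp 2 0, by exact_mod_cast fourierLp_mem_H2 0⟩ (hg ▸ Submodule.mem_top)
  rw [diskEval_fourierLp_zero] at h1
  exact one_ne_zero h1

/-- Positivity of the Pick matrix of `g` controls the functionals on `[A g]` that come from `L²`. -/
theorem norm_sum_le_of_posSemidef {n : ℕ} {x : Fin n → 𝔻} {v : Fin n → ellTwo} {w : Fin n → ℂ}
    {α : ℝ} (hα : 0 ≤ α) (hA : A ≤ HInf) (h1 : Lp.const ∞ haarAddCircle (1 : ℂ) ∈ A)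
    (hg : IsOuter g) (hg1 : ‖g‖ = 1) (hQ : (pickMatrix A x v w α g).PosSemidef)
    {c : Fin n → ℂ} {p : ℕ → CircleLp 2} {C : ℝ} (hC : 0 ≤ C)
    (hp : ∀ s : Finset ℕ, ∑ k ∈ s, ‖p k‖ ^ 2 ≤ C ^ 2)
    (hpc : ∀ k, ∀ a ∈ A, inner ℂ (p k) (mulL a g) =
      ∑ j, c j * conj (v j k) * diskEval a (x j)) :
    ‖∑ j, c j * w j‖ ≤ α * C := by
  -- Evaluating $ag$ at $x_j$ gives $a(x_j)g(x_j)$; dividing by $g(x_j)$ leaves $a(x_j)$.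
  set b : Fin n → ℂ := fun j => conj (c j / diskEval (g : CircleLp 2) (x j)) with hb
  have hg0 := fun j => hg.diskEval_ne_zero (x j)
  set q : ℕ → cyclicSubspace A g := fun k =>
    lincomb (fun j => kernelVector A g (x j)) fun j => b j * v j k with hq
  -- So $q_k$ is the orthogonal projection of $p_k$ to $[Ag]$, whence $\|q_k\|\le\|p_k\|$.
  have hqp : ∀ k, ∀ u : cyclicSubspace A g,
      inner ℂ (q k) u = inner ℂ (p k) ((u : H2) : CircleLp 2) := by
    intro k u
    let φ : H2 →L[ℂ] ℂ :=
      ∑ j, conj (b j * v j k) • (diskEvalCLM (x j) ∘L H2.subtypeL)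
    have hφ : ∀ u, φ u = ∑ j, conj (b j * v j k) * diskEval (u : CircleLp 2) (x j) := by
      intro u
      rw [sum_apply]
      rfl
    rw [hq, inner_lincomb_kernelVector, ← hφ]
    refine eqOn_cyclicSubspace (ψ := innerSL ℂ (p k) ∘L H2.subtypeL) hA (fun a ha => ?_) u u.2
    rw [hφ]
    change _ = inner ℂ (p k) (mulL a g)
    rw [hpc k a ha]
    refine Finset.sum_congr rfl fun j _ => ?_
    change _ * diskEval (mulL a g) (x j) = _
    rw [diskEval_mulL (hA ha) g.2, hb, map_mul, Complex.conj_conj]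
    have := hg0 j
    field_simp
  have hqn : ∀ k, ‖q k‖ ≤ ‖p k‖ := by
    intro k
    have h : ‖q k‖ ^ 2 ≤ ‖p k‖ * ‖q k‖ := by
      have h₁ := norm_inner_le_norm (𝕜 := ℂ) (p k) ((q k : H2) : CircleLp 2)
      rw [← hqp, inner_self_eq_norm_sq_to_K] at h₁
      simpa using h₁
    by_contra! hlt
    have := (norm_nonneg (p k)).trans_lt hlt
    nlinarith
  have hS : ∑' k, ‖q k‖ ^ 2 ≤ C ^ 2 := by
    refine (summable_norm_sq_lincomb _ v b).tsum_le_of_sum_le fun s => (hp s).trans' ?_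
    exact Finset.sum_le_sum fun k _ => pow_le_pow_left₀ (norm_nonneg _) (hqn k) 2
  have hy := (pickMatrix_posSemidef_iff x v w α).1 hQ b
  set y : cyclicSubspace A g :=
    lincomb (fun j => kernelVector A g (x j)) fun j => b j * conj (w j) with hyd
  have hyn : ‖y‖ ≤ α * C := by
    refine (sq_le_sq₀ (norm_nonneg _) (by positivity)).1 ?_
    rw [mul_pow]
    exact hy.trans (mul_le_mul_of_nonneg_left hS (by positivity))
  -- Pairing with the unit vector $g$, which is in $[Ag]$ because $1\in A$, cancels the factors
  -- $g(x_j)$.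
  have hyg : inner ℂ y (⟨g, self_mem_cyclicSubspace hA h1⟩ : cyclicSubspace A g) =
      ∑ j, c j * w j := by
    rw [hyd, inner_lincomb_kernelVector]
    refine Finset.sum_congr rfl fun j _ => ?_
    rw [hb, map_mul, Complex.conj_conj, Complex.conj_conj]
    have := hg0 j
    field_simp
  rw [← hyg]
  refine (norm_inner_le_norm _ _).trans ?_
  have : ‖(⟨g, self_mem_cyclicSubspace hA h1⟩ : cyclicSubspace A g)‖ = 1 := hg1
  rw [this, mul_one]
  exact hyn

end Kernel

/-! ### Functionals on `L¹(ℓ²)` -/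

/-- `L¹` functions on the circle with values in `ℓ²`. -/
abbrev CircleL1ellTwo : Type := Lp ellTwo 1 (haarAddCircle : Measure UnitAddCircle)

/-- The `k`-th entry of an `ℓ²`-valued integrable function. -/
def entry (k : ℕ) : CircleL1ellTwo →L[ℂ] CircleLp 1 :=
  (lp.evalCLM ℂ (fun _ : ℕ => ℂ) 2 k).compLpL 1 haarAddCircle

theorem coeFn_entry (k : ℕ) (h : CircleL1ellTwo) :
    entry k h =ᵐ[haarAddCircle] fun t => h t k :=
  ContinuousLinearMap.coeFn_compLpL _ h

/-- The function `t ↦ P(t) a`, for `a ∈ ℓ²` and `P ∈ L¹`. -/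
def tensor : ellTwo →L[ℂ] CircleLp 1 →L[ℂ] CircleL1ellTwo :=
  ContinuousLinearMap.compLpL₂ 1 haarAddCircle (ContinuousLinearMap.lsmul ℂ ℂ).flip

theorem coeFn_tensor (a : ellTwo) (P : CircleLp 1) :
    tensor a P =ᵐ[haarAddCircle] fun t => P t • a :=
  ContinuousLinearMap.coeFn_compLpL ((ContinuousLinearMap.lsmul ℂ ℂ).flip a) P

theorem norm_tensor_le (a : ellTwo) (P : CircleLp 1) : ‖tensor a P‖ ≤ ‖a‖ * ‖P‖ := by
  rw [L1.norm_eq_integral_norm, L1.norm_eq_integral_norm, ← integral_const_mul]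
  refine (integral_congr_ae ?_).le
  filter_upwards [coeFn_tensor a P] with t ht
  rw [ht, norm_smul, mul_comm]

theorem entry_tensor (k : ℕ) (a : ellTwo) (P : CircleLp 1) :
    entry k (tensor a P) = a k • P := by
  refine Lp.ext ?_
  filter_upwards [coeFn_entry k (tensor a P), coeFn_tensor a P, Lp.coeFn_smul (a k) P]
    with t h₁ h₂ h₃
  rw [h₁, h₂, h₃, Pi.smul_apply, smul_eq_mul, lp.coeFn_smul, Pi.smul_apply, smul_eq_mul, mul_comm]

theorem sum_norm_sq_le_norm_sq (a : ellTwo) (s : Finset ℕ) : ∑ k ∈ s, ‖a k‖ ^ 2 ≤ ‖a‖ ^ 2 := by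
  have h := lp.sum_rpow_le_norm_rpow (p := 2) (by norm_num) a s
  simpa using h

/-- An `ℓ²`-valued integrable function factors as a product of an outer function and a square
integrable `ℓ²`-valued function. -/
theorem exists_outer_factorization (h : CircleL1ellTwo) {δ : ℝ} (hδ : 0 < δ) :
    ∃ g : H2, IsOuter g ∧ ‖g‖ = 1 ∧ ∃ p : ℕ → CircleLp 2,
      (∀ s : Finset ℕ, ∑ k ∈ s, ‖p k‖ ^ 2 ≤ (‖h‖ + δ) ^ 2) ∧
      ∀ (a : CircleLp ∞) (k : ℕ), inner ℂ (p k) (mulL a g) = pairing a (entry k h) := by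
  set D : ℝ := ‖h‖ + δ with hD
  have hD0 : 0 < D := by positivity
  have hint : Integrable (fun t => ‖h t‖) haarAddCircle := (L1.integrable_coeFn h).norm
  have hI : ∫ t, ‖h t‖ ∂haarAddCircle = ‖h‖ := (L1.norm_eq_integral_norm h).symm
  -- Adding $\delta$ bounds $r$ away from zero; dividing by $D$ gives $\int r^2=1$.
  set r : UnitAddCircle → ℝ := fun t => √((‖h t‖ + δ) / D) with hr
  have hr2 : ∀ t, r t ^ 2 = (‖h t‖ + δ) / D := fun t => Real.sq_sqrt (by positivity)
  have hrm : AEStronglyMeasurable r haarAddCircle := by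
    have : Measurable fun t => ‖h t‖ := (Lp.stronglyMeasurable h).norm.measurable
    exact (Measurable.sqrt ((this.add_const δ).div_const D)).aestronglyMeasurable
  have hrL : MemLp r 2 haarAddCircle := by
    rw [memLp_two_iff_integrable_sq hrm]
    simp_rw [hr2]
    exact (hint.add (integrable_const δ)).div_const D
  obtain ⟨g, hg, hgr⟩ := exists_isOuter_norm_eq hrL (δ := √(δ / D)) (by positivity) fun t =>
    Real.sqrt_le_sqrt (by gcongr; linarith [norm_nonneg (h t)])
  have hgn : ‖g‖ = 1 := by
    have h₁ := L2.inner_def (𝕜 := ℂ) (g : CircleLp 2) (g : CircleLp 2)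
    have h₂ : ∫ t, inner ℂ ((g : CircleLp 2) t) ((g : CircleLp 2) t) ∂haarAddCircle =
        ((∫ t, (‖h t‖ + δ) / D ∂haarAddCircle : ℝ) : ℂ) := by
      refine Eq.trans ?_ (integral_ofReal (𝕜 := ℂ))
      refine integral_congr_ae ?_
      filter_upwards [hgr] with t ht
      rw [inner_self_eq_norm_sq_to_K, ht, ← hr2]
      push_cast
      rfl
    rw [h₂, integral_div, integral_add hint (integrable_const δ), hI, integral_const,
      probReal_univ, one_smul, div_self hD0.ne', inner_self_eq_norm_sq_to_K] at h₁
    have h₃ : ‖(g : CircleLp 2)‖ ^ 2 = 1 := by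
      apply Complex.ofReal_injective
      rw [Complex.ofReal_pow]
      exact h₁
    exact (pow_eq_one_iff_of_nonneg (norm_nonneg _) two_ne_zero).1 h₃
  have hg0 : ∀ᵐ t ∂haarAddCircle, ‖(g : CircleLp 2) t‖ ^ 2 = (‖h t‖ + δ) / D := by
    filter_upwards [hgr] with t ht
    rw [ht, hr2]
  -- The quotient is $D\|h\|^2/(\|h\|+\delta)$; its bound integrates to $D\|h\|_1\le D^2$.
  have hquot : ∀ᵐ t ∂haarAddCircle, ‖h t‖ ^ 2 / ‖(g : CircleLp 2) t‖ ^ 2 ≤ D * ‖h t‖ := by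
    filter_upwards [hg0] with t ht
    rw [ht, div_div_eq_mul_div, div_le_iff₀ (by positivity)]
    nlinarith [norm_nonneg (h t), mul_nonneg hD0.le (mul_nonneg (norm_nonneg (h t)) hδ.le)]
  have hentm : ∀ k, AEStronglyMeasurable (fun t => h t k) haarAddCircle := fun k =>
    (Lp.aestronglyMeasurable (entry k h)).congr (coeFn_entry k h)
  -- The choice $p_k=\overline{h_k/g}$ makes $\langle ag,p_k\rangle=\int ah_k$.
  have hpm : ∀ k, MemLp (fun t => conj (h t k / (g : CircleLp 2) t)) 2
      (haarAddCircle (T := 1)) := by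
    intro k
    have hm : AEStronglyMeasurable (fun t => conj (h t k / (g : CircleLp 2) t))
        (haarAddCircle (T := 1)) :=
      Complex.continuous_conj.comp_aestronglyMeasurable
        ((hentm k).div₀ (Lp.aestronglyMeasurable (g : CircleLp 2)))
    rw [memLp_two_iff_integrable_sq_norm hm]
    refine (hint.const_mul D).mono' (hm.norm.pow 2) ?_
    filter_upwards [hquot] with t ht
    rw [Real.norm_of_nonneg (by positivity), RCLike.norm_conj, norm_div, div_pow]
    refine le_trans ?_ ht
    gcongr
    exact lp.norm_apply_le_norm (by norm_num) (h t) k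
  refine ⟨g, hg, hgn, fun k => (hpm k).toLp _, fun s => ?_, fun a k => ?_⟩
  · have h₁ : ∀ k, ‖((hpm k).toLp _ : CircleLp 2)‖ ^ 2 =
        ∫ t, ‖h t k‖ ^ 2 / ‖(g : CircleLp 2) t‖ ^ 2 ∂haarAddCircle := by
      intro k
      have := norm_normSqL1 ((hpm k).toLp _)
      rw [← this, L1.norm_eq_integral_norm]
      refine integral_congr_ae ?_
      filter_upwards [coeFn_normSqL1 ((hpm k).toLp _), (hpm k).coeFn_toLp] with t h₁ h₂
      rw [h₁, h₂, norm_mul, RCLike.norm_conj, RCLike.norm_conj, norm_div]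
      ring
    have h₂ : ∀ k, Integrable (fun t => ‖h t k‖ ^ 2 / ‖(g : CircleLp 2) t‖ ^ 2)
        (haarAddCircle (T := 1)) := by
      intro k
      refine ((memLp_two_iff_integrable_sq_norm (hpm k).1).1 (hpm k)).congr (.of_forall fun t => ?_)
      simp only [RCLike.norm_conj, norm_div, div_pow]
    simp_rw [h₁]
    rw [← integral_finsetSum _ fun k _ => h₂ k]
    calc _ ≤ ∫ t, D * ‖h t‖ ∂haarAddCircle := by
          refine integral_mono_ae (integrable_finsetSum _ fun k _ => h₂ k) (hint.const_mul D) ?_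
          filter_upwards [hquot] with t ht
          refine le_trans ?_ ht
          rw [← Finset.sum_div]
          gcongr
          exact sum_norm_sq_le_norm_sq (h t) s
      _ = D * ‖h‖ := by rw [integral_const_mul, hI]
      _ ≤ D ^ 2 := by nlinarith
  · rw [L2.inner_def, pairing_apply]
    refine integral_congr_ae ?_
    filter_upwards [coeFn_mulL a g, (hpm k).coeFn_toLp, coeFn_entry k h, hg0] with t h₁ h₂ h₃ h₄
    have : (g : CircleLp 2) t ≠ 0 := by
      intro h0
      rw [h0, norm_zero] at h₄
      have : 0 < (‖h t‖ + δ) / D := by positivity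
      rw [← h₄] at this
      simp at this
    rw [h₁, h₂, h₃, RCLike.inner_apply, Complex.conj_conj]
    field_simp

/-- Both sides are the symmetric bilinear sum $\sum_k a_kb_k$. -/
theorem inner_star_left (a b : ellTwo) : inner ℂ (star a) b = inner ℂ (star b) a := by
  rw [lp.inner_eq_tsum, lp.inner_eq_tsum]
  refine tsum_congr fun k => ?_
  simp [mul_comm]

/-- Positivity of all the Pick matrices implies the existence of an interpolating function. -/
theorem exists_interpolating_column {n : ℕ} {A : Submodule ℂ (CircleLp ∞)}
    (hA : IsUnitalWeakStarClosedSubalgebra A)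
    {x : Fin n → 𝔻} {v : Fin n → ellTwo} {w : Fin n → ℂ} {α : ℝ} (hα : 0 ≤ α)
    (hQ : ∀ g : H2, IsOuter g → ‖g‖ = 1 → (pickMatrix A x v w α g).PosSemidef) :
    ∃ F ∈ columnFunctions A,
      (∀ z : 𝔻, ‖F z‖ ≤ α) ∧ ∀ j, inner ℂ (F (x j)) (v j) = conj (w j) := by
  choose P hP1 hP using exists_representing_density
  have hP' : ∀ z, ∀ a ∈ A, pairing a (P z) = diskEval a z := fun z a ha => by
    rw [pairing_apply, hP z a (hA.le_HInf ha)]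
  let N : Submodule ℂ CircleL1ellTwo :=
    ⨅ (k : ℕ) (a : A), (pairing (a : CircleLp ∞) ∘L entry k).toLinearMap.ker
  have hN : ∀ m, m ∈ N ↔ ∀ k, ∀ a ∈ A, pairing a (entry k m) = 0 := by
    intro m
    simp [N, Submodule.mem_iInf]
  let T : (Fin n → ℂ) × N →ₗ[ℂ] CircleL1ellTwo :=
    (Fintype.linearCombination ℂ fun j => tensor (star (v j)) (P (x j))).coprod N.subtype
  let l : (Fin n → ℂ) × N →ₗ[ℂ] ℂ := (Fintype.linearCombination ℂ w).comp (LinearMap.fst ℂ _ _)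
  have hT : ∀ c m, T (c, m) = ∑ j, c j • tensor (star (v j)) (P (x j)) + m := by
    intro c m
    simp [T, Fintype.linearCombination_apply]
  have hl : ∀ c m, l (c, m) = ∑ j, c j * w j := by
    intro c m
    simp [l, Fintype.linearCombination_apply]
  have hbound : ∀ y, ‖l y‖ ≤ α * ‖T y‖ := by
    rintro ⟨c, m⟩
    rw [hl]
    have hδ : ∀ δ > 0, ‖∑ j, c j * w j‖ ≤ α * (‖T (c, m)‖ + δ) := by
      intro δ hδ
      obtain ⟨g, hg, hg1, p, hp, hpa⟩ := exists_outer_factorization (T (c, m)) hδ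
      refine norm_sum_le_of_posSemidef hα hA.le_HInf hA.one_mem hg hg1 (hQ g hg hg1)
        (by positivity) hp fun k a ha => ?_
      rw [hpa, hT, map_add, map_add, (hN m).1 m.2 k a ha, add_zero, map_sum, map_sum]
      refine Finset.sum_congr rfl fun j _ => ?_
      rw [map_smul, map_smul, entry_tensor, map_smul, hP' _ a ha, lp.star_apply, RCLike.star_def,
        smul_eq_mul, smul_eq_mul, mul_assoc]
    -- The denominator $\alpha+1$ also covers $\alpha=0$.
    refine le_of_forall_pos_le_add fun ε hε => (hδ (ε / (α + 1)) (by positivity)).trans ?_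
    rw [mul_add]
    have : α * (ε / (α + 1)) ≤ ε := by
      rw [mul_div_assoc', div_le_iff₀ (by positivity)]
      nlinarith
    linarith
  obtain ⟨Λ, hΛ, hΛT⟩ := exists_clm_comp_eq T l hα hbound
  have hΛN : ∀ m ∈ N, Λ m = 0 := by
    intro m hm
    have := hΛT (0, ⟨m, hm⟩)
    rw [hT, hl] at this
    simpa using this
  have hΛw : ∀ j, Λ (tensor (star (v j)) (P (x j))) = w j := by
    intro j
    have := hΛT (Pi.single j 1, 0)
    rw [hT, hl] at this
    simpa [Pi.single_apply, Finset.sum_ite_eq] using this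
  -- If $m\in L^1$ annihilates $A$, then placing $m$ in the $k$-th coordinate gives an element of
  -- $N$, which $\Lambda$ kills; weak* closedness puts $f_k$ in $A$.
  have hf : ∀ k : ℕ, ∃ f ∈ A, ∀ m, pairing f m = Λ (tensor (lp.single 2 k 1) m) := by
    intro k
    obtain ⟨f, hf⟩ := exists_pairing_eq (Λ ∘L tensor (lp.single 2 k (1 : ℂ)))
    refine ⟨f, mem_of_forall_pairing_eq_zero hA.isClosed fun m hm => ?_, fun m => by rw [hf]; rfl⟩
    rw [hf, ContinuousLinearMap.comp_apply]
    refine hΛN _ ((hN _).2 fun i a ha => ?_)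
    rw [entry_tensor, map_smul, hm a ha, smul_zero]
  choose f hfA hf using hf
  let τ : 𝔻 → StrongDual ℂ ellTwo := fun z => Λ ∘L tensor.flip (P z)
  have hτ : ∀ z a, τ z a = Λ (tensor a (P z)) := fun z a => rfl
  -- The functional $a\mapsto\Lambda(aP_z)$ is $\sum_k a_kf_k(z)$, so $F(z)=\overline{\rho(z)}$; its
  -- norm is at most $\alpha$ because $\|P_z\|_1=1$.
  let ρ : 𝔻 → ellTwo := fun z => (InnerProductSpace.toDual ℂ ellTwo).symm (τ z)
  have hρ : ∀ z a, inner ℂ (ρ z) a = τ z a := fun z a => InnerProductSpace.toDual_symm_apply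
  refine ⟨fun z => star (ρ z), fun k => ⟨f k, hfA k, fun z => ?_⟩, fun z => ?_, fun j => ?_⟩
  · have h := hρ z (lp.single 2 k (1 : ℂ))
    rw [lp.inner_single_right, hτ, ← hf k, hP' z _ (hfA k)] at h
    rw [← h, lp.star_apply]
    simp
  · rw [norm_star, LinearIsometryEquiv.norm_map]
    refine ContinuousLinearMap.opNorm_le_bound _ hα fun a => ?_
    rw [hτ]
    refine (Λ.le_of_opNorm_le hΛ _).trans ?_
    have := norm_tensor_le a (P z)
    rw [hP1, mul_one] at this
    gcongr
  · rw [inner_star_left, ← inner_conj_symm, hρ, hτ, hΛw]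

/-! ### Multiplication by a bounded column -/

theorem fourier_natCast_apply (n : ℕ) (t : UnitAddCircle) :
    fourier (n : ℤ) t = (fourier 1 t : ℂ) ^ n := by
  induction n with
  | zero => simp
  | succ n ih => rw [Nat.cast_succ, fourier_add, ih, pow_succ]

/-- The point `R e^{2πit}` of the disk. -/
def circlePoint {R : ℝ} (hR : 0 ≤ R) (hR1 : R < 1) (t : UnitAddCircle) : 𝔻 :=
  .mk (R * fourier 1 t) (by
    rw [norm_mul, Complex.norm_real, Real.norm_of_nonneg hR, fourier_apply, Circle.norm_coe, mul_one]
    exact hR1)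

/-- The mean of `|u|²` over a circle of radius `R < 1`. -/
theorem exists_dilation (u : CircleLp 2) {R : ℝ} (hR : 0 ≤ R) (hR1 : R < 1) :
    ∃ φ : C(UnitAddCircle, ℂ), (∀ t, φ t = diskEval u (circlePoint hR hR1 t)) ∧
      HasSum (fun n : ℕ => ‖fourierCoeff u n‖ ^ 2 * (R ^ n) ^ 2)
        (∫ t, ‖φ t‖ ^ 2 ∂haarAddCircle) := by
  set c : ℕ → ℂ := fun n => fourierCoeff u n * (R : ℂ) ^ n with hc
  have hsum : Summable fun n : ℕ => c n • fourier (T := 1) (n : ℤ) := by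
    refine .of_norm_bounded ((summable_geometric_of_lt_one hR hR1).mul_left ‖u‖) fun n => ?_
    rw [norm_smul, fourier_norm, mul_one, hc, norm_mul, norm_pow, Complex.norm_real,
      Real.norm_of_nonneg hR]
    exact mul_le_mul_of_nonneg_right (norm_fourierCoeff_le u n) (by positivity)
  obtain ⟨φ, hφ⟩ := hsum
  have hcoef : ∀ m : ℤ, HasSum (fun n : ℕ => c n * if m = n then 1 else 0)
      (fourierCoeff (ContinuousMap.toLp 2 haarAddCircle ℂ φ : CircleLp 2) m) := by
    intro m
    have h := hφ.mapL (fourierCoeffCLM m ∘L ContinuousMap.toLp 2 haarAddCircle ℂ)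
    rw [ContinuousLinearMap.comp_apply, fourierCoeffCLM_apply] at h
    refine h.congr_fun fun n => ?_
    rw [map_smul, smul_eq_mul, ← fourierCoeff_fourierLp, ← fourierCoeffCLM_apply]
    rfl
  have hnat : ∀ m : ℕ, fourierCoeff (ContinuousMap.toLp 2 haarAddCircle ℂ φ : CircleLp 2) m =
      c m := by
    intro m
    refine (hcoef m).unique ?_
    have h := hasSum_single (f := fun n : ℕ => c n * if (m : ℤ) = n then 1 else 0) m
      fun n hn => by
        rw [if_neg (by exact_mod_cast hn.symm), mul_zero]
    simpa using h
  have hneg : ∀ m : ℤ, m < 0 →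
      fourierCoeff (ContinuousMap.toLp 2 haarAddCircle ℂ φ : CircleLp 2) m = 0 := by
    intro m hm
    refine (hcoef m).unique (hasSum_zero.congr_fun fun n => ?_)
    rw [if_neg (by omega), mul_zero]
  refine ⟨φ, fun t => ?_, ?_⟩
  · have h := hφ.mapL (ContinuousMap.evalCLM ℂ t)
    refine h.unique ((summable_diskEval u (circlePoint hR hR1 t)).hasSum.congr_fun fun n => ?_)
    change c n * fourier (n : ℤ) t = fourierCoeff u n * ((R : ℂ) * fourier 1 t) ^ n
    rw [hc, fourier_natCast_apply, mul_pow]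
    ring
  · have h := hasSum_sq_fourierCoeff (ContinuousMap.toLp 2 haarAddCircle ℂ φ : CircleLp 2)
    have hI : ∫ t, ‖(ContinuousMap.toLp 2 haarAddCircle ℂ φ : CircleLp 2) t‖ ^ 2 ∂haarAddCircle =
        ∫ t, ‖φ t‖ ^ 2 ∂haarAddCircle := by
      refine integral_congr_ae ?_
      filter_upwards [ContinuousMap.coeFn_toLp haarAddCircle (p := 2) (𝕜 := ℂ) φ] with t ht
      rw [ht]
    rw [hI] at h
    have hinj : Function.Injective ((↑) : ℕ → ℤ) := Nat.cast_injective
    refine ((hinj.hasSum_iff ?_).2 h).congr_fun fun n => ?_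
    · intro m hm
      rw [hneg m (by contrapose! hm; exact ⟨m.toNat, by simpa using hm⟩), norm_zero]
      simp
    · rw [Function.comp_apply, hnat, hc, norm_mul, norm_pow, Complex.norm_real,
        Real.norm_of_nonneg hR, mul_pow]

theorem hasSum_norm_sq_fourierCoeff {u : CircleLp 2} (hu : u ∈ H2) :
    HasSum (fun n : ℕ => ‖fourierCoeff u n‖ ^ 2) (‖u‖ ^ 2) := by
  have h := hasSum_sq_fourierCoeff u
  have hI : ∫ t, ‖u t‖ ^ 2 ∂haarAddCircle = ‖u‖ ^ 2 := by
    rw [← norm_normSqL1, L1.norm_eq_integral_norm]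
    refine integral_congr_ae ?_
    filter_upwards [coeFn_normSqL1 u] with t ht
    rw [ht, norm_mul, RCLike.norm_conj, sq]
  rw [hI] at h
  have hinj : Function.Injective ((↑) : ℕ → ℤ) := Nat.cast_injective
  refine (hinj.hasSum_iff ?_).2 h
  intro m hm
  rw [hu m (by contrapose! hm; exact ⟨m.toNat, by simpa using hm⟩), norm_zero]
  simp

/-- A column of functions in `H^∞` bounded by `α` in the disk multiplies `H²` into a column of
norm at most `α`. -/
theorem sum_norm_mulL_sq_le {f : ℕ → CircleLp ∞} (hf : ∀ k, f k ∈ HInf) {α : ℝ} (s : Finset ℕ)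
    (hα : ∀ z : 𝔻, ∑ k ∈ s, ‖diskEval (f k) z‖ ^ 2 ≤ α ^ 2) {u : CircleLp 2} (hu : u ∈ H2) :
    ∑ k ∈ s, ‖mulL (f k) u‖ ^ 2 ≤ α ^ 2 * ‖u‖ ^ 2 := by
  have hfu : ∀ k, mulL (f k) u ∈ H2 := fun k => mulL_mem_H2 (hf k) hu
  -- Integrate the pointwise bound over the circle of radius $R$ and apply Parseval there.
  have hR : ∀ R : ℝ, ∀ (h0 : 0 ≤ R) (h1 : R < 1), ∀ I : Finset ℕ,
      ∑ n ∈ I, ∑ k ∈ s, ‖fourierCoeff (mulL (f k) u) n‖ ^ 2 * (R ^ n) ^ 2 ≤ α ^ 2 * ‖u‖ ^ 2 := by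
    intro R h0 h1 I
    choose φ hφ hφs using fun k => exists_dilation (mulL (f k) u) h0 h1
    obtain ⟨ψ, hψ, hψs⟩ := exists_dilation u h0 h1
    have hi : ∀ χ : C(UnitAddCircle, ℂ), Integrable (fun t => ‖χ t‖ ^ 2) haarAddCircle := fun χ =>
      ((χ.continuous.norm.pow 2).integrable_of_hasCompactSupport
        (HasCompactSupport.of_compactSpace _))
    rw [Finset.sum_comm]
    calc ∑ k ∈ s, ∑ n ∈ I, ‖fourierCoeff (mulL (f k) u) n‖ ^ 2 * (R ^ n) ^ 2
        ≤ ∑ k ∈ s, ∫ t, ‖φ k t‖ ^ 2 ∂haarAddCircle :=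
          Finset.sum_le_sum fun k _ => sum_le_hasSum I (fun n _ => by positivity) (hφs k)
      _ = ∫ t, ∑ k ∈ s, ‖φ k t‖ ^ 2 ∂haarAddCircle :=
          (integral_finsetSum _ fun k _ => hi (φ k)).symm
      _ ≤ ∫ t, α ^ 2 * ‖ψ t‖ ^ 2 ∂haarAddCircle := by
          refine integral_mono (integrable_finsetSum _ fun k _ => hi (φ k)) ((hi ψ).const_mul _)
            fun t => ?_
          simp only [hφ, hψ, diskEval_mulL (hf _) hu, norm_mul, mul_pow, ← Finset.sum_mul]
          gcongr
          exact hα _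
      _ = α ^ 2 * ∫ t, ‖ψ t‖ ^ 2 ∂haarAddCircle := integral_const_mul _ _
      _ ≤ α ^ 2 * ‖u‖ ^ 2 := by
          gcongr
          refine hasSum_le (fun n => ?_) hψs (hasSum_norm_sq_fourierCoeff hu)
          refine mul_le_of_le_one_right (by positivity) ?_
          exact pow_le_one₀ (by positivity) (pow_le_one₀ h0 h1.le)
  -- For finitely many coefficients, $R\to1$ is continuity of a polynomial; no radial boundary
  -- limits are needed.
  have h1 : ∀ I : Finset ℕ, ∑ n ∈ I, ∑ k ∈ s, ‖fourierCoeff (mulL (f k) u) n‖ ^ 2 ≤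
      α ^ 2 * ‖u‖ ^ 2 := by
    intro I
    have hc : Continuous fun R : ℝ =>
        ∑ n ∈ I, ∑ k ∈ s, ‖fourierCoeff (mulL (f k) u) n‖ ^ 2 * (R ^ n) ^ 2 := by fun_prop
    have ht := (hc.tendsto 1).mono_left (nhdsWithin_le_nhds (s := Set.Iio 1))
    simp only [one_pow, mul_one] at ht
    refine le_of_tendsto ht ?_
    filter_upwards [Ioo_mem_nhdsLT zero_lt_one] with R hR'
    exact hR R hR'.1.le hR'.2 I
  exact hasSum_le_of_sum_le (hasSum_sum fun k _ => hasSum_norm_sq_fourierCoeff (hfu k)) h1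

/-! ### The adjoint of column multiplication on $[Ag]$ -/

theorem mulL_mem_cyclicSubspace_of_mem {A : Submodule ℂ (CircleLp ∞)} {g : H2} (hA : A ≤ HInf)
    (hmul : ∀ f ∈ A, ∀ g ∈ A, (f • g : CircleLp ∞) ∈ A) {a : CircleLp ∞} (ha : a ∈ A) {u : H2}
    (hu : u ∈ cyclicSubspace A g) :
    (⟨mulL a u, mulL_mem_H2 (hA ha) u.2⟩ : H2) ∈ cyclicSubspace A g := by
  let m : H2 →L[ℂ] H2 := (mulL a ∘L H2.subtypeL).codRestrict H2 fun u => mulL_mem_H2 (hA ha) u.2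
  have hle : cyclicSubspace A g ≤ (cyclicSubspace A g).comap m.toLinearMap := by
    refine Submodule.topologicalClosure_minimal _ (Submodule.span_le.2 ?_)
      ((Submodule.isClosed_topologicalClosure _).preimage m.continuous)
    rintro u' ⟨a', ha', hu'⟩
    refine Submodule.le_topologicalClosure _ (Submodule.subset_span ⟨_, hmul a ha a' ha', ?_⟩)
    change mulL a u' = mulL (a • a') g
    rw [hu']
    refine Lp.ext ?_
    filter_upwards [coeFn_mulL a (a' • (g : CircleLp 2)), coeFn_mulL a' g,
      coeFn_mulL (a • a' : CircleLp ∞) g, Lp.coeFn_lpSMul (r := ∞) a a'] with t h₁ h₂ h₃ h₄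
    rw [mulL_apply] at h₂
    rw [h₁, h₂, h₃, h₄, Pi.smul_apply', smul_eq_mul, mul_assoc]
  exact hle hu

/-- Cauchy–Schwarz gives $\|y\|^2\le(\sum_k\|q_k\|^2)^{1/2}\,\alpha\|y\|$; then cancel $\|y\|$. -/
theorem norm_sq_le_of_hasSum_inner {E : Type*} [NormedAddCommGroup E] [InnerProductSpace ℂ E]
    {y : E} {q m : ℕ → E} {α : ℝ} (hα : 0 ≤ α) (hqs : Summable fun k => ‖q k‖ ^ 2)
    (hms : ∀ s : Finset ℕ, ∑ k ∈ s, ‖m k‖ ^ 2 ≤ (α * ‖y‖) ^ 2)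
    (hsum : HasSum (fun k => inner ℂ (q k) (m k)) (inner ℂ y y)) :
    ‖y‖ ^ 2 ≤ α ^ 2 * ∑' k, ‖q k‖ ^ 2 := by
  have hle : ‖y‖ ^ 2 ≤ √(∑' k, ‖q k‖ ^ 2) * (α * ‖y‖) := by
    have h₁ : ‖inner ℂ y y‖ ≤ √(∑' k, ‖q k‖ ^ 2) * (α * ‖y‖) := by
      refine le_of_tendsto hsum.norm (.of_forall fun s => ?_)
      calc ‖∑ k ∈ s, inner ℂ (q k) (m k)‖ ≤ ∑ k ∈ s, ‖q k‖ * ‖m k‖ :=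
            norm_sum_le_of_le s fun k _ => norm_inner_le_norm _ _
        _ ≤ √(∑ k ∈ s, ‖q k‖ ^ 2) * √(∑ k ∈ s, ‖m k‖ ^ 2) := Real.sum_mul_le_sqrt_mul_sqrt _ _ _
        _ ≤ √(∑' k, ‖q k‖ ^ 2) * √((α * ‖y‖) ^ 2) := by
            gcongr
            · exact hqs.sum_le_tsum s fun k _ => by positivity
            · exact hms s
        _ = _ := by rw [Real.sqrt_sq (by positivity)]
    rwa [inner_self_eq_norm_sq_to_K, norm_pow, RCLike.norm_ofReal, abs_norm] at h₁
  have hS : 0 ≤ ∑' k, ‖q k‖ ^ 2 := tsum_nonneg fun k => by positivity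
  have hle' : ‖y‖ ≤ α * √(∑' k, ‖q k‖ ^ 2) := by
    by_contra! hlt
    have h0 : 0 < ‖y‖ := hlt.trans_le' (by positivity)
    nlinarith
  calc ‖y‖ ^ 2 ≤ (α * √(∑' k, ‖q k‖ ^ 2)) ^ 2 := pow_le_pow_left₀ (norm_nonneg _) hle' 2
    _ = α ^ 2 * ∑' k, ‖q k‖ ^ 2 := by rw [mul_pow, Real.sq_sqrt hS]

/-- Here $m$ plays the column $F$ times $y$. Pairing it with $q_k=\sum_jb_jv_j(k)\kappa_j$ and
summing over $k$ produces $\langle F(x_j),v_j\rangle$, so the interpolation conditions turn the sum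
into $\|y\|^2$. -/
theorem norm_sq_lincomb_le {E : Type*} [NormedAddCommGroup E] [InnerProductSpace ℂ E] {n : ℕ}
    {κ : Fin n → E} {v F : Fin n → ellTwo} {w b : Fin n → ℂ} {y : E} {m : ℕ → E} {α : ℝ}
    (hα : 0 ≤ α) (hF : ∀ j, inner ℂ (F j) (v j) = conj (w j))
    (hy : y = lincomb κ fun j => b j * conj (w j))
    (hm : ∀ k j, inner ℂ (κ j) (m k) = F j k * inner ℂ (κ j) y)
    (hms : ∀ s : Finset ℕ, ∑ k ∈ s, ‖m k‖ ^ 2 ≤ (α * ‖y‖) ^ 2) :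
    ‖y‖ ^ 2 ≤ α ^ 2 * ∑' k, ‖lincomb κ fun j => b j * v j k‖ ^ 2 := by
  refine norm_sq_le_of_hasSum_inner hα (summable_norm_sq_lincomb κ v b) hms ?_
  have h₁ : inner ℂ y y = ∑ j, conj (b j) * inner ℂ (κ j) y * inner ℂ (v j) (F j) := by
    conv_lhs => enter [2]; rw [hy]
    rw [inner_lincomb_left]
    refine Finset.sum_congr rfl fun j _ => ?_
    rw [← inner_conj_symm (v j), hF, Complex.conj_conj, map_mul, Complex.conj_conj]
    ring
  have h₂ : ∀ k, inner ℂ (lincomb κ fun j => b j * v j k) (m k) =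
      ∑ j, conj (b j) * inner ℂ (κ j) y * inner ℂ (v j k) (F j k) := by
    intro k
    rw [inner_lincomb_left]
    refine Finset.sum_congr rfl fun j _ => ?_
    rw [hm, RCLike.inner_apply, map_mul]
    ring
  rw [h₁]
  simp_rw [h₂]
  refine hasSum_sum fun j _ => ?_
  have h₃ := lp.hasSum_inner (𝕜 := ℂ) (v j) (F j)
  exact h₃.mul_left (conj (b j) * inner ℂ (κ j) y)

theorem norm_coe_cyclicSubspace {A : Submodule ℂ (CircleLp ∞)} {g : H2}
    (u : cyclicSubspace A g) : ‖((u : H2) : CircleLp 2)‖ = ‖u‖ := rfl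

/-- The existence of an interpolating function implies positivity of the Pick matrices. -/
theorem pickMatrix_posSemidef {n : ℕ} {A : Submodule ℂ (CircleLp ∞)}
    (hA : IsUnitalWeakStarClosedSubalgebra A)
    {x : Fin n → 𝔻} {v : Fin n → ellTwo} {w : Fin n → ℂ} {α : ℝ} (hα : 0 ≤ α)
    {F : 𝔻 → ellTwo} (hF : F ∈ columnFunctions A) (hFα : ∀ z, ‖F z‖ ≤ α)
    (hFw : ∀ j, inner ℂ (F (x j)) (v j) = conj (w j)) (g : H2) :
    (pickMatrix A x v w α g).PosSemidef := by
  rw [pickMatrix_posSemidef_iff]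
  intro b
  choose f hfA hf using hF
  have hfH : ∀ k, f k ∈ HInf := fun k => hA.le_HInf (hfA k)
  obtain ⟨y, hy⟩ : ∃ y : cyclicSubspace A g, y =
    lincomb (fun j => kernelVector A g (x j)) fun j => b j * conj (w j) := ⟨_, rfl⟩
  rw [← hy]
  obtain ⟨m, hm⟩ : ∃ m : ℕ → cyclicSubspace A g, ∀ k,
      ((m k : H2) : CircleLp 2) = mulL (f k) (y : H2) :=
    ⟨fun k => ⟨_, mulL_mem_cyclicSubspace_of_mem hA.le_HInf hA.mul_mem (hfA k) y.2⟩, fun _ => rfl⟩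
  have hmk : ∀ k j, inner ℂ (kernelVector A g (x j)) (m k) =
      F (x j) k * inner ℂ (kernelVector A g (x j)) y := by
    intro k j
    rw [inner_kernelVector, inner_kernelVector, hf, hm, diskEval_mulL (hfH k) (y : H2).2]
  have hms : ∀ s : Finset ℕ, ∑ k ∈ s, ‖m k‖ ^ 2 ≤ (α * ‖y‖) ^ 2 := by
    intro s
    have hn : ∀ k, ‖m k‖ = ‖mulL (f k) (y : H2)‖ := fun k => by
      rw [← hm k, norm_coe_cyclicSubspace]
    rw [mul_pow, ← norm_coe_cyclicSubspace y, Finset.sum_congr rfl fun k _ => by rw [hn k]]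
    refine sum_norm_mulL_sq_le hfH s (fun z => ?_) (y : H2).2
    simp_rw [← hf]
    exact (sum_norm_sq_le_norm_sq (F z) s).trans
      (pow_le_pow_left₀ (norm_nonneg _) (hFα z) 2)
  exact norm_sq_lincomb_le (E := cyclicSubspace A g) hα hFw hy hmk hms

end

theorem theorem1p1 {n : ℕ} (A : Submodule ℂ (CircleLp ∞))
    (hA : IsUnitalWeakStarClosedSubalgebra A)
    (x : Fin n → 𝔻) (v : Fin n → ellTwo) (w : Fin n → ℂ) (α : ℝ) (hα : 0 ≤ α) :
    (∃ F ∈ columnFunctions A,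
        (∀ z : 𝔻, ‖F z‖ ≤ α) ∧ ∀ j, inner ℂ (F (x j)) (v j) = conj (w j)) ↔
      ∀ g : H2, IsOuter g → ‖g‖ = 1 → (pickMatrix A x v w α g).PosSemidef := by
  constructor
  · rintro ⟨F, hF, hFα, hFw⟩ g _ _
    exact pickMatrix_posSemidef hA hα hF hFα hFw g
  · exact exists_interpolating_column hA hα
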